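/- Conventions. A $k$-graph is a countable category $\Lambda$ with a degree functor $d:\Lambda\to\mathbf N^k$ with the factorisation property: if $d(\lambda)=m+p$, then $\lambda=\mu\nu$ for unique $\mu,\nu$ with $d(\mu)=m$, $d(\nu)=p$. Vertices are the identity morphisms; $r$ and $s$ denote codomain and domain, and $\mu\nu$ is defined if and only if $s(\mu)=r(\nu)$. For a row-finite, locally convex $\Lambda$, $C^*(\Lambda)$ is the universal $C^*$-algebra generated by a Cuntz–Krieger family, that is, by partial isometries $s_\lambda$ ($\lambda\in\Lambda$) such that the $p_v:=s_v$ ($v$ a vertex) are mutually orthogonal projections, $s_\mu s_\nu=s_{\mu\nu}$ if $s(\mu)=r(\nu)$, $s_\lambda^*s_\lambda=p_{s(\lambda)}$, and $p_v=\sum_{\lambda\in v\Lambda^{\le m}}s_\lambda s_\lambda^*$ for all vertices $v$ and $m\in\mathbf N^k$. Here $v\Lambda^{\le m}$ is the set of paths $\lambda$ with $r(\lambda)=v$ and $d(\lambda)\le m$ such that $r(\mu)=s(\lambda)$ and $d(\lambda\mu)\le m$ force $\mu=s(\lambda)$. The gauge action $\gamma$ of $\mathbf T^k$ is given by $\gamma_z(s_\lambda)=z^{d(\lambda)}s_\lambda$;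 its fixed-point algebra $C^*(\Lambda)^\gamma$ is called the core. Let $n\ge 1$, and write $\mathbf N=\{1,2,\dots\}$ for the index set of the vertices. Let $\Lambda_n$ be the $2$-graph with vertices $v_1,v_2,\dots$ in which each $v_i$ is the range of exactly one edge $e_i$ of degree $(1,0)$ and exactly one edge $f_i$ of degree $(0,1)$, both with source $v_{i-1}$ if $i\ge 2$ and with source $v_n$ if $i=1$ (this determines $\Lambda_n$). In $C^*(\Lambda_n)$ put $\theta_{i,j}:=s_{e_j}s_{e_{j-1}}\cdots s_{e_{i+1}}$ for $i<j$, $\theta_{i,i}:=p_{v_i}$, and $\theta_{i,j}:=\theta_{j,i}^*$ for $i>j$; thus $\theta_{i,j}$ has initial projection $p_{v_i}$ and final projection $p_{v_j}$. Put $$u_1:=s_{e_n}\cdots s_{e_2}s_{e_1},\qquad u_2:=s_{e_n}\cdots s_{e_2}s_{f_1}.$$ **Lemma 7.2.** The universal $C^*$-algebra $C^*(\Lambda_n)$ exists and has the following properties. (1) The $\theta_{i,j}$ are nonzero and form a system of matrix units: $\theta_{i,j}^*=\theta_{j,i}$, and $\theta_{k,l}\theta_{i,j}$ equals $\theta_{i,l}$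 if $j=k$ and $0$ otherwise. (2) For $i=1,2$ the sum $U_i:=\sum_{j\in\mathbf N}\theta_{n,j}\,u_i\,\theta_{j,n}$ converges strictly in the multiplier algebra $\mathcal M(C^*(\Lambda_n))$. The elements $U_1$ and $U_2$ are commuting unitaries, and the spectrum of each is the whole unit circle. (3) $C^*(\Lambda_n)$ is generated by the $\theta_{i,j}$ together with $U_1,U_2$, in the sense that it is the closed linear span of the elements $\theta_{i,j}U_1^aU_2^b$ with $i,j\in\mathbf N$ and $a,b\in\mathbf Z$. (4) Let $\mathcal K$ be the $C^*$-algebra of compact operators on $\ell^2(\mathbf N)$, and let $\Theta_{i,j}\in\mathcal K$ be the rank-one operator that maps the basis vector $\delta_i$ to $\delta_j$ and all the other basis vectors to $0$. There is a $*$-isomorphism of $C^*(\Lambda_n)$ onto $\mathcal K\otimes C(\mathbf T^2)=C(\mathbf T^2,\mathcal K)$ that maps $\theta_{i,j}U_1^aU_2^b$ to the function $(w,z)\mapsto w^az^b\,\Theta_{i,j}$ for all $i,j\in\mathbf N$ and $a,b\in\mathbf Z$. (5) The core $C^*(\Lambda_n)^\gamma$ is $*$-isomorphic to $\bigoplus_{j=1}^n\mathcal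 K$. -/

import Mathlib

open CategoryTheory MultiplierAlgebra
open scoped InnerProductSpace

universe u

/-! ### Higher-rank graphs

Composition of paths follows the categorical convention: for `μ : b ⟶ c` and `ν : a ⟶ b` (so that
`s(μ) = b = r(ν)`) the path written `μν` in the literature is `ν ≫ μ : a ⟶ c`.
The source of `μ : b ⟶ c` is `b`, its range is `c`. -/

/-- A `k`-graph: a countable small category with a degree functor to the monoid `ℕ^k` that has the
factorisation property. The vertices are the objects, the paths are the morphisms. -/
class KGraph (k : outParam ℕ) (V : Type) [SmallCategory V] where
  deg : ∀ {a b : V}, (a ⟶ b) → (Fin k → ℕ)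
  deg_id : ∀ a : V, deg (𝟙 a) = 0
  deg_comp : ∀ {a b c : V} (ν : a ⟶ b) (μ : b ⟶ c), deg (ν ≫ μ) = deg μ + deg ν
  countable : Countable (Σ a b : V, a ⟶ b)
  factorisation : ∀ {a c : V} (l : a ⟶ c) (m n : Fin k → ℕ), deg l = m + n →
    ∃! p : Σ b : V, (b ⟶ c) × (a ⟶ b),
      deg p.2.1 = m ∧ deg p.2.2 = n ∧ p.2.2 ≫ p.2.1 = l

namespace KGraph

variable {k : ℕ} (V : Type) [SmallCategory V] [KGraph k V]

/-- The set `v Λ` of all paths with range `v`. -/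
abbrev PathsTo {V : Type} [SmallCategory V] (v : V) : Type := Σ a : V, a ⟶ v

/-- `v Λ^n` is finite for every vertex `v` and every degree `n`. -/
def RowFinite : Prop :=
  ∀ (v : V) (n : Fin k → ℕ), {p : PathsTo v | deg p.2 = n}.Finite

/-- If `e` is an edge of degree `e_i` and `j ≠ i`, then `s(e) Λ^{e_j} = ∅` only if
`r(e) Λ^{e_j} = ∅`. -/
def LocallyConvex : Prop :=
  ∀ (a b : V) (e : a ⟶ b) (i j : Fin k), i ≠ j → deg e = Pi.single i 1 →
    {p : PathsTo a | deg p.2 = Pi.single j 1} = ∅ →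
      {p : PathsTo b | deg p.2 = Pi.single j 1} = ∅

variable {V}

/-- The set `v Λ^{≤ n}`: the paths `l` with range `v` and `d(l) ≤ n` such that the only `μ` with
`r(μ) = s(l)` and `d(lμ) ≤ n` is the vertex `s(l)`. -/
def pathsLE (v : V) (n : Fin k → ℕ) : Set (PathsTo v) :=
  {l | deg l.2 ≤ n ∧ ∀ μ : PathsTo l.1, deg (μ.2 ≫ l.2) ≤ n → μ = ⟨l.1, 𝟙 l.1⟩}

end KGraph

/-! ### Cuntz–Krieger families and the universal C*-algebra -/

/-- A Cuntz–Krieger family of a (row-finite, locally convex) `k`-graph in a C*-algebra. For such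
graphs the sum in `ck4` is over a finite set. -/
structure CKFamily {k : ℕ} (V : Type) [SmallCategory V] [KGraph k V]
    (A : Type u) [NonUnitalCStarAlgebra A] where
  S : ∀ {a b : V}, (a ⟶ b) → A
  partialIsometry : ∀ {a b : V} (l : a ⟶ b), S l * star (S l) * S l = S l
  ck1_proj : ∀ v : V, IsStarProjection (S (𝟙 v))
  ck1_orth : ∀ v w : V, v ≠ w → S (𝟙 v) * S (𝟙 w) = 0
  ck2 : ∀ {a b c : V} (ν : a ⟶ b) (μ : b ⟶ c), S μ * S ν = S (ν ≫ μ)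
  ck3 : ∀ {a b : V} (l : a ⟶ b), star (S l) * S l = S (𝟙 a)
  ck4 : ∀ (v : V) (n : Fin k → ℕ),
    S (𝟙 v) = ∑ᶠ p : KGraph.pathsLE v n, S p.1.2 * star (S p.1.2)

namespace CKFamily

variable {k : ℕ} {V : Type} [SmallCategory V] [KGraph k V]
  {A : Type u} [NonUnitalCStarAlgebra A]

/-- `(A, S)` is the universal C*-algebra generated by a Cuntz–Krieger family, i.e. it is
`C*(Λ)` together with its canonical generators `s_l`. -/
structure IsUniversal (S : CKFamily V A) : Prop where
  generates : (NonUnitalStarAlgebra.adjoin ℂ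
    {x : A | ∃ (a b : V) (l : a ⟶ b), x = S.S l}).topologicalClosure = ⊤
  exists_hom : ∀ (B : Type u) [NonUnitalCStarAlgebra B] (T : CKFamily V B),
    ∃ π : A →⋆ₙₐ[ℂ] B, ∀ {a b : V} (l : a ⟶ b), π (S.S l) = T.S l

end CKFamily

/-- `z^d = z_1^{d_1} ⋯ z_k^{d_k}` for `z` in the `k`-torus and `d ∈ ℕ^k`. -/
noncomputable def torusPow {k : ℕ} (z : Fin k → Circle) (d : Fin k → ℕ) : ℂ :=
  ((∏ i, z i ^ d i : Circle) : ℂ)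

theorem torusPow_zero {k : ℕ} (z : Fin k → Circle) : torusPow z 0 = 1 := by
  simp [torusPow]

theorem torusPow_add {k : ℕ} (z : Fin k → Circle) (d e : Fin k → ℕ) :
    torusPow z (d + e) = torusPow z d * torusPow z e := by
  simp only [torusPow, Pi.add_apply, pow_add, Finset.prod_mul_distrib, Circle.coe_mul]

theorem torusPow_mul_star {k : ℕ} (z : Fin k → Circle) (d : Fin k → ℕ) :
    torusPow z d * star (torusPow z d) = 1 := by
  unfold torusPow
  rw [Complex.star_def, Complex.mul_conj, Circle.normSq_coe]
  simp

theorem star_mul_torusPow {k : ℕ} (z : Fin k → Circle) (d : Fin k → ℕ) :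
    star (torusPow z d) * torusPow z d = 1 := by
  rw [mul_comm, torusPow_mul_star]

namespace CKFamily

variable {k : ℕ} {V : Type} [SmallCategory V] [KGraph k V]
  {A : Type u} [NonUnitalCStarAlgebra A]

/-- The Cuntz–Krieger family `l ↦ z^{d(l)} s_l`. -/
noncomputable def twist (S : CKFamily V A) (z : Fin k → Circle) : CKFamily V A where
  S l := torusPow z (KGraph.deg l) • S.S l
  partialIsometry l := by
    simp only [star_smul, smul_mul_assoc, mul_smul_comm, smul_smul, S.partialIsometry]
    rw [mul_comm (star _), torusPow_mul_star, mul_one]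
  ck1_proj v := by
    simpa only [KGraph.deg_id, torusPow_zero, one_smul] using S.ck1_proj v
  ck1_orth v w h := by
    simp only [KGraph.deg_id, torusPow_zero, one_smul, S.ck1_orth v w h]
  ck2 ν μ := by
    simp only [smul_mul_assoc, mul_smul_comm, smul_smul, KGraph.deg_comp, torusPow_add, S.ck2,
      mul_comm]
  ck3 l := by
    simp only [star_smul, smul_mul_assoc, mul_smul_comm, smul_smul, KGraph.deg_id, torusPow_zero,
      S.ck3, torusPow_mul_star]
  ck4 v n := by
    simp only [star_smul, smul_mul_assoc, mul_smul_comm, smul_smul, KGraph.deg_id, torusPow_zero,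
      star_mul_torusPow, one_smul]
    exact S.ck4 v n

/-- The gauge action `γ_z` on `C*(Λ)`: the *-homomorphism with `γ_z(s_l) = z^{d(l)} s_l` supplied by
the universal property (it is unique because the `s_l` generate). -/
noncomputable def gauge {S : CKFamily V A} (hS : S.IsUniversal) (z : Fin k → Circle) :
    A →⋆ₙₐ[ℂ] A :=
  (hS.exists_hom A (S.twist z)).choose

theorem gauge_apply {S : CKFamily V A} (hS : S.IsUniversal) (z : Fin k → Circle)
    {a b : V} (l : a ⟶ b) : gauge hS z (S.S l) = torusPow z (KGraph.deg l) • S.S l :=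
  (hS.exists_hom A (S.twist z)).choose_spec l

/-- The core: the fixed-point algebra `C*(Λ)^γ` of the gauge action. -/
noncomputable def core {S : CKFamily V A} (hS : S.IsUniversal) : NonUnitalStarSubalgebra ℂ A where
  carrier := {x | ∀ z : Fin k → Circle, gauge hS z x = x}
  add_mem' hx hy z := by rw [map_add, hx z, hy z]
  zero_mem' z := map_zero _
  mul_mem' hx hy z := by rw [map_mul, hx z, hy z]
  smul_mem' c x hx z := by rw [map_smul, hx z]
  star_mem' hx z := by rw [map_star, hx z]

end CKFamily

/-! ### The 2-graph `Λ_n`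

The vertices are `v_1, v_2, …`. Each vertex `v_i` is the range of exactly one solid edge `e_i`
(degree `(1,0)`) and exactly one dashed edge `f_i` (degree `(0,1)`); both have source `v_{i-1}` if
`i ≥ 2`, and both have source `v_n` if `i = 1`. The factorisation rule, the only possible one, is
`e f = f e` along the two-step paths. Hence a path is determined by its range `v_i` and its degree
`(a,b)`, and its source is reached from `v_i` by going back `a + b` steps. -/

/-- The vertex set `{v_1, v_2, …}` of `Λ_n`; the vertex `v_i` is `⟨i⟩`. -/
@[ext]
structure LambdaN (n : ℕ+) where
  idx : ℕ+

namespace LambdaN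

variable {n : ℕ+}

/-- The common source of the edges `e_i` and `f_i`: it is `v_n` if `i = 1`, and `v_{i-1}`
if `i ≥ 2`. -/
def prev (v : LambdaN n) : LambdaN n := ⟨if v.idx = 1 then n else v.idx - 1⟩

/-- The paths with source `a` and range `b`. -/
@[ext]
structure Path (a b : LambdaN n) where
  deg : Fin 2 → ℕ
  source_eq : prev^[deg 0 + deg 1] b = a

instance : SmallCategory (LambdaN n) where
  Hom a b := Path a b
  id _ := ⟨0, rfl⟩
  comp {a b c} f g := ⟨g.deg + f.deg, by
    have h : (g.deg + f.deg) 0 + (g.deg + f.deg) 1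
        = (f.deg 0 + f.deg 1) + (g.deg 0 + g.deg 1) := by
      simp only [Pi.add_apply]; omega
    rw [h, Function.iterate_add_apply, g.source_eq, f.source_eq]⟩
  id_comp f := Path.ext (add_zero f.deg)
  comp_id f := Path.ext (zero_add f.deg)
  assoc f g h := Path.ext (add_assoc h.deg g.deg f.deg).symm

instance : KGraph 2 (LambdaN n) where
  deg f := Path.deg f
  deg_id _ := rfl
  deg_comp _ _ := rfl
  countable := by
    have : Countable (LambdaN n) := 
      Function.Injective.countable (f := LambdaN.idx) fun _ _ h => LambdaN.ext h
    have hp : ∀ a b : LambdaN n, Countable (a ⟶ b) := fun a b =>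
      Function.Injective.countable (f := fun f : a ⟶ b => Path.deg f) fun _ _ h => Path.ext h
    infer_instance
  factorisation {a c} l m d h := by
    have hl := l.source_eq
    have h' : l.deg = m + d := h
    refine ⟨⟨prev^[m 0 + m 1] c, ⟨m, rfl⟩, ⟨d, ?_⟩⟩, ⟨rfl, rfl, Path.ext h'.symm⟩, ?_⟩
    · have hs : l.deg 0 + l.deg 1 = (d 0 + d 1) + (m 0 + m 1) := by
        rw [h']; simp only [Pi.add_apply]; omega
      rw [← Function.iterate_add_apply, ← hl, hs]
    · rintro ⟨b, ⟨m', hm⟩, ⟨d', hd⟩⟩ ⟨h1, h2, -⟩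
      change m' = m at h1
      change d' = d at h2
      subst h1 h2 hm
      rfl

/-- Each vertex receives exactly one path of each degree. -/
theorem existsUnique_path (v : LambdaN n) (d : Fin 2 → ℕ) :
    ∃! p : KGraph.PathsTo v, KGraph.deg p.2 = d := by
  refine ⟨⟨prev^[d 0 + d 1] v, ⟨d, rfl⟩⟩, rfl, ?_⟩
  rintro ⟨a, ⟨d', h⟩⟩ h'
  change d' = d at h'
  subst h' h
  rfl

theorem rowFinite : KGraph.RowFinite (LambdaN n) := fun v d => by
  obtain ⟨p, -, hp⟩ := existsUnique_path v d
  exact (Set.finite_singleton p).subset hp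

theorem locallyConvex : KGraph.LocallyConvex (LambdaN n) := fun a _ _ _ j _ _ h => by
  obtain ⟨p, hp, -⟩ := existsUnique_path a (Pi.single j 1)
  exact absurd (show p ∈ (∅ : Set _) from h ▸ hp) (Set.notMem_empty p)

/-- The solid edge `e_i`, with range `v_i`. -/
def e (n i : ℕ+) : prev (⟨i⟩ : LambdaN n) ⟶ ⟨i⟩ := Path.mk ![1, 0] rfl

/-- The dashed edge `f_i`, with range `v_i`. -/
def f (n i : ℕ+) : prev (⟨i⟩ : LambdaN n) ⟶ ⟨i⟩ := Path.mk ![0, 1] rfl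

end LambdaN

/-! ### The elements `θ_{i,j}`, `u_1`, `u_2` -/

namespace CKFamily

variable {n : ℕ+} {A : Type u} [NonUnitalCStarAlgebra A]

/-- `tail i m = s_{e_{i+m}} ⋯ s_{e_{i+2}} s_{e_{i+1}} p_{v_i}`. -/
noncomputable def tail (S : CKFamily (LambdaN n) A) (i : ℕ+) : ℕ → A
  | 0 => S.S (𝟙 (⟨i⟩ : LambdaN n))
  | m + 1 => S.S (LambdaN.e n (i + m.succPNat)) * tail S i m

/-- `θ_{i,j} = s_{e_j} ⋯ s_{e_{i+1}}` if `i < j`, `θ_{i,i} = p_{v_i}`, and `θ_{i,j} = θ_{j,i}^*` if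
`i > j`. -/
noncomputable def theta (S : CKFamily (LambdaN n) A) (i j : ℕ+) : A :=
  if i ≤ j then S.tail i ((j : ℕ) - i) else star (S.tail j ((i : ℕ) - j))

/-- `u_1 = s_{e_n} ⋯ s_{e_2} s_{e_1}`, with source and range `v_n`. -/
noncomputable def u₁ (S : CKFamily (LambdaN n) A) : A := S.theta 1 n * S.S (LambdaN.e n 1)

/-- `u_2 = s_{e_n} ⋯ s_{e_2} s_{f_1}`, with source and range `v_n`. -/
noncomputable def u₂ (S : CKFamily (LambdaN n) A) : A := S.theta 1 n * S.S (LambdaN.f n 1)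

end CKFamily

/-- A system of matrix units: `E_{i,j} E_{k,l} = δ_{j,k} E_{i,l}` and `E_{i,j}^* = E_{j,i}`. -/
structure IsMatrixUnits {ι A : Type*} [DecidableEq ι] [NonUnitalCStarAlgebra A]
    (E : ι → ι → A) : Prop where
  mul_eq : ∀ i j k l, E i j * E k l = if j = k then E i l else 0
  star_eq : ∀ i j, star (E i j) = E j i

/-- The multiplier `U` is the sum `∑ x_j` in the strict topology of the multiplier algebra.
Here `U.fst a = U a` and `U.snd a = a U`. -/
def HasStrictSum {ι A : Type*} [NonUnitalCStarAlgebra A] (x : ι → A) (U : 𝓜(ℂ, A)) : Prop :=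
  ∀ a : A, HasSum (fun j => x j * a) (U.fst a) ∧ HasSum (fun j => a * x j) (U.snd a)

/-! ### The compact operators -/

/-- The Hilbert space `ℓ²(ℕ)`, with `ℕ = {1, 2, …}`. -/
abbrev EllTwo : Type := lp (fun _ : ℕ+ => ℂ) 2

/-- The adjoint of a compact operator on a Hilbert space is compact. -/
theorem IsCompactOperator.adjoint_of_hilbert {H : Type*} [NormedAddCommGroup H]
    [InnerProductSpace ℂ H] [CompleteSpace H] {T : H →L[ℂ] H} (hT : IsCompactOperator T) :
    IsCompactOperator (ContinuousLinearMap.adjoint T) := by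
  set R := ContinuousLinearMap.adjoint T with hR
  have hTR : IsCompactOperator (T ∘L R) := hT.comp_clm R
  have h1 := hTR.isCompact_closure_image_closedBall 1
  have h2 : TotallyBounded ((T ∘L R) '' Metric.closedBall 0 1) :=
    h1.totallyBounded.subset subset_closure
  have h3 : TotallyBounded (R '' Metric.closedBall 0 1) := by
    rw [Metric.totallyBounded_iff]
    intro ε hε
    obtain ⟨t, htB, htf, hcov⟩ := Metric.finite_approx_of_totallyBounded h2 (ε ^ 2 / 4)
      (by positivity)
    obtain ⟨t', ht'B, hbij⟩ := Set.SurjOn.exists_bijOn_subset htB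
    have ht'f : t'.Finite := hbij.finite_iff_finite.mpr htf
    obtain rfl := hbij.image_eq
    refine ⟨R '' t', ht'f.image _, ?_⟩
    rintro _ ⟨x, hx, rfl⟩
    have := hcov (Set.mem_image_of_mem _ hx)
    simp only [Set.mem_iUnion, Set.mem_image, exists_prop] at this ⊢
    obtain ⟨_, ⟨y, hy, rfl⟩, hxy⟩ := this
    refine ⟨R y, ⟨y, hy, rfl⟩, ?_⟩
    have hyB := ht'B hy
    rw [Metric.mem_ball, dist_eq_norm, ← map_sub] at hxy ⊢
    rw [mem_closedBall_zero_iff] at hx hyB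
    have hd : ‖x - y‖ ≤ 2 := (norm_sub_le _ _).trans (by linarith)
    have key : ‖R (x - y)‖ ^ 2 ≤ ‖(T ∘L R) (x - y)‖ * ‖x - y‖ := by
      have : ‖R (x - y)‖ ^ 2 = RCLike.re ⟪(T ∘L R) (x - y), x - y⟫_ℂ := by
        rw [ContinuousLinearMap.comp_apply, ← ContinuousLinearMap.adjoint_inner_right, ← hR,
          inner_self_eq_norm_sq]
      rw [this]
      exact (RCLike.re_le_norm _).trans (norm_inner_le_norm _ _)
    have : ‖R (x - y)‖ ^ 2 < ε ^ 2 := by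
      nlinarith [norm_nonneg ((T ∘L R) (x - y)), norm_nonneg (x - y), sq_nonneg ε, pow_pos hε 2]
    exact lt_of_pow_lt_pow_left₀ 2 hε.le this
  refine (isCompactOperator_iff_isCompact_closure_image_closedBall (R : H →ₗ[ℂ] H) one_pos).mpr ?_
  exact h3.closure.isCompact_of_isClosed isClosed_closure

/-- The C*-algebra `𝒦` of compact operators on `ℓ²(ℕ)`. -/
def CompactOps : NonUnitalStarSubalgebra ℂ (EllTwo →L[ℂ] EllTwo) where
  carrier := {T | IsCompactOperator T}
  add_mem' hS hT := hS.add hT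
  zero_mem' := isCompactOperator_zero
  mul_mem' {_ T} hS _ := hS.comp_clm T
  smul_mem' c _ hT := hT.smul c
  star_mem' hT := hT.adjoint_of_hilbert

instance : IsClosed (CompactOps : Set (EllTwo →L[ℂ] EllTwo)) :=
  isClosed_setOfPred_isCompactOperator

/-- The rank-one operator `Θ_{i,j}` that maps the basis vector `δ_i` to `δ_j` and all the other
basis vectors to `0`. -/
noncomputable def Theta (i j : ℕ+) : EllTwo →L[ℂ] EllTwo :=
  InnerProductSpace.rankOne ℂ (lp.single 2 j 1 : EllTwo) (lp.single 2 i 1 : EllTwo)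

/-! In `Λ_n` a path is determined by its range and its degree, and every degree occurs. Hence each
sum in the last Cuntz–Krieger relation has one term, and every `s_λ` is a partial isometry from
`p_{s(λ)}` onto `p_{r(λ)}`. The solid edges `e_2, e_3, …` yield matrix units linking all vertices.
What remains is the pair of commuting unitaries `u_1`, `u_2` in the corner of `p_{v_n}`. Since `e f
= f e` expresses each dashed edge through the previous one and solid edges, these data determine the
family (`CKFamily.S_eq_of_theta_eq`).

Conversely, nothing else constrains `u_1` and `u_2`, so the algebra is that of continuous functions
from the torus to `𝒦`. In `model` a path from `v_i` to `v_j` becomes `Θ_{i,j}` times a monomial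
whose exponents record the passages through `v_1` and the number of dashed edges. For the universal
property, Gelfand duality (`exists_corner_calculus`) turns the unitaries `u_1`, `u_2` of any family
into a homomorphism `φ` of the scalar functions into the corner, and `IsMatrixUnits.exists_hom`
extends it by `g Θ_{i,j} ↦ θ_{n,j} φ(g) θ_{i,n}`. So every realisation is isomorphic to the model,
where `U_1` and `U_2` are multiplication by the two coordinates of the torus.

In the model the gauge automorphism at `z` is a rotation of the torus combined with the factor `(z
0) ^ (j - i)` on the matrix unit from `i` to `j`. The rotations are transitive, and the stabiliser
of a point is a copy of the `n`-th roots of unity. An invariant entry is therefore determined by its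
value at one point. It vanishes unless `n` divides `i - j`, and is otherwise a multiple of `w ^ ((i
- j) / n)`. The residue classes modulo `n` give the `n` copies of `𝒦` in the core.

The compact operators enter only through `RankOneUnits`, and the torus only through a homeomorphic
space `X`, which lets the model live in any universe. -/

open Filter Topology

/-! ### Matrix units and approximation on totally bounded sets. -/

namespace IsMatrixUnits

variable {ι A : Type*} [DecidableEq ι] [NonUnitalCStarAlgebra A] {E : ι → ι → A}

theorem mul_same (hE : IsMatrixUnits E) (i j k : ι) : E i j * E j k = E i k := by
  rw [hE.mul_eq, if_pos rfl]

theorem mul_ne (hE : IsMatrixUnits E) {i j k l : ι} (h : j ≠ k) : E i j * E k l = 0 := by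
  rw [hE.mul_eq, if_neg h]

theorem isStarProjection_sum (hE : IsMatrixUnits E) (F : Finset ι) :
    IsStarProjection (∑ j ∈ F, E j j) where
  isIdempotentElem := by
    simp only [IsIdempotentElem, Finset.sum_mul_sum, hE.mul_eq, Finset.sum_ite_eq]
    exact Finset.sum_congr rfl fun j hj => if_pos hj
  isSelfAdjoint := by
    simp only [IsSelfAdjoint, star_sum, hE.star_eq]

end IsMatrixUnits

theorem continuous_starHom {A B : Type*} [NonUnitalCStarAlgebra A] [NonUnitalCStarAlgebra B]
    (φ : A →⋆ₙₐ[ℂ] B) : Continuous φ :=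
  AddMonoidHomClass.continuous_of_bound φ 1 fun g => by
    simpa using NonUnitalStarAlgHom.norm_apply_le φ g

/-- Contractions converging pointwise to the identity converge uniformly on totally bounded
sets. -/
theorem TotallyBounded.eventually_norm_sub_lt {ι E : Type*} {l : Filter ι} [NormedAddCommGroup E]
    [NormedSpace ℂ E] {P : ι → E →L[ℂ] E} (hP : ∀ i, ‖P i‖ ≤ 1)
    (hlim : ∀ v, Tendsto (fun i => P i v) l (𝓝 v)) {s : Set E} (hs : TotallyBounded s)
    {ε : ℝ} (hε : 0 < ε) : ∀ᶠ i in l, ∀ v ∈ s, ‖P i v - v‖ < ε := by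
  obtain ⟨t, ht, hst⟩ := Metric.totallyBounded_iff.1 hs (ε / 3) (by positivity)
  have h1 : ∀ᶠ i in l, ∀ y ∈ t, ‖P i y - y‖ < ε / 3 := by
    refine (eventually_all_finite ht).2 fun y _ => ?_
    have := (Metric.tendsto_nhds.1 (hlim y)) (ε / 3) (by positivity)
    simpa only [dist_eq_norm] using this
  filter_upwards [h1] with i hi v hv
  obtain ⟨y, hy, hvy⟩ : ∃ y ∈ t, ‖v - y‖ < ε / 3 := by
    simpa [dist_eq_norm] using hst hv
  have h2 : ‖P i (v - y)‖ < ε / 3 :=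
    (((P i).le_of_opNorm_le (hP i) _).trans_eq (one_mul _)).trans_lt hvy
  calc ‖P i v - v‖ = ‖P i (v - y) + (P i y - y) - (v - y)‖ := by rw [map_sub]; congr 1; abel
    _ ≤ ‖P i (v - y)‖ + ‖P i y - y‖ + ‖v - y‖ :=
      (norm_sub_le _ _).trans (add_le_add_left (norm_add_le _ _) _)
    _ < ε := by linarith [hi y hy]

/-- A system of rank one matrix units in a C*-algebra, `unit i j` mapping the `i`-th basis vector
to the `j`-th one, whose diagonal projections add up to the identity. -/
structure RankOneUnits (K : Type*) [NonUnitalCStarAlgebra K] where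
  unit : ℕ+ → ℕ+ → K
  isMatrixUnits : IsMatrixUnits (fun j i => unit i j)
  ne_zero : ∀ i j, unit i j ≠ 0
  entry : ℕ+ → ℕ+ → K →L[ℂ] ℂ
  mul_mul : ∀ i j T, unit j j * T * unit i i = entry i j T • unit i j
  tendsto_sum_mul : ∀ T, Tendsto (fun F : Finset ℕ+ => (∑ j ∈ F, unit j j) * T) atTop (𝓝 T)

/-! ### Matrix units in the compact operators -/

theorem isCompactOperator_Theta (i j : ℕ+) : IsCompactOperator (Theta i j) := by
  have h : IsCompactOperator (ContinuousLinearMap.toSpanSingleton ℂ (lp.single 2 j 1 : EllTwo)) :=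
    isCompactOperator_of_locallyCompactSpace_rng _
  rw [Theta, InnerProductSpace.rankOne_def']
  exact h.comp_clm _

/-- `Theta i j` as an element of the algebra of compact operators. -/
noncomputable def thetaK (i j : ℕ+) : CompactOps := ⟨Theta i j, isCompactOperator_Theta i j⟩

theorem inner_single_single (i j : ℕ+) :
    ⟪(lp.single 2 i 1 : EllTwo), (lp.single 2 j 1 : EllTwo)⟫_ℂ = if i = j then 1 else 0 := by
  rw [lp.inner_single_left, lp.single_apply]
  by_cases h : i = j
  · subst h; simp
  · simp [h]

theorem isMatrixUnits_thetaK : IsMatrixUnits (fun j i => thetaK i j) where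
  mul_eq i j k l := by
    apply Subtype.ext
    change Theta j i ∘L Theta l k = _
    rw [Theta, Theta, InnerProductSpace.rankOne_comp_rankOne, inner_single_single]
    split_ifs with h
    · rw [one_smul]; rfl
    · rw [zero_smul]; rfl
  star_eq i j := Subtype.ext (InnerProductSpace.adjoint_rankOne _ _)

theorem thetaK_ne_zero (i j : ℕ+) : thetaK i j ≠ 0 := fun h => by
  have h' : Theta i j = 0 := congrArg Subtype.val h
  rw [Theta, InnerProductSpace.rankOne_eq_zero] at h'
  have key : ∀ k : ℕ+, (lp.single 2 k 1 : EllTwo) ≠ 0 := fun k hk => by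
    simpa [hk] using inner_single_single k k
  exact h'.elim (key j) (key i)

/-- The matrix entry of `T` with row `j` and column `i`. -/
noncomputable def entryK (i j : ℕ+) : CompactOps →L[ℂ] ℂ where
  toFun T := ⟪(lp.single 2 j 1 : EllTwo), (T : EllTwo →L[ℂ] EllTwo) (lp.single 2 i 1)⟫_ℂ
  map_add' S T := by simp
  map_smul' c T := by simp
  cont := by
    have : Continuous fun T : EllTwo →L[ℂ] EllTwo =>
      ⟪(lp.single 2 j 1 : EllTwo), T (lp.single 2 i 1)⟫_ℂ := by fun_prop
    exact this.comp continuous_subtype_val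

theorem thetaK_mul_mul (i j : ℕ+) (T : CompactOps) :
    thetaK j j * T * thetaK i i = entryK i j T • thetaK i j := by
  apply Subtype.ext
  change (Theta j j ∘L (T : EllTwo →L[ℂ] EllTwo)) ∘L Theta i i = entryK i j T • Theta i j
  ext1 v
  simp only [Theta, ContinuousLinearMap.comp_apply, InnerProductSpace.rankOne_apply,
    map_smul, smul_apply]
  rw [smul_smul, smul_smul, mul_comm]
  rfl

/-- A compact operator maps the unit ball to a totally bounded set. There the coordinate
projections, which converge strongly, converge uniformly, and this is convergence in norm of the
products. -/
theorem tendsto_sum_thetaK_mul (T : CompactOps) :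
    Tendsto (fun F : Finset ℕ+ => (∑ j ∈ F, thetaK j j) * T) atTop (𝓝 T) := by
  have hP : ∀ F : Finset ℕ+, ‖((∑ j ∈ F, thetaK j j : CompactOps) : EllTwo →L[ℂ] EllTwo)‖ ≤ 1 :=
    fun F => IsStarProjection.norm_le (∑ j ∈ F, thetaK j j)
      (isMatrixUnits_thetaK.isStarProjection_sum F)
  have hlim : ∀ v : EllTwo, Tendsto (fun F : Finset ℕ+ =>
      ((∑ j ∈ F, thetaK j j : CompactOps) : EllTwo →L[ℂ] EllTwo) v) atTop (𝓝 v) := fun v => by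
    have h := lp.hasSum_single (E := fun _ : ℕ+ => ℂ) (p := 2) (by simp) v
    refine Tendsto.congr (fun F => ?_) h
    have : ((∑ j ∈ F, thetaK j j : CompactOps) : EllTwo →L[ℂ] EllTwo) = ∑ j ∈ F, Theta j j :=
      map_sum (NonUnitalStarSubalgebraClass.subtype CompactOps) _ _
    rw [this, sum_apply]
    refine Finset.sum_congr rfl fun j _ => ?_
    rw [Theta, InnerProductSpace.rankOne_apply, lp.inner_single_left, ← lp.single_smul]
    simp
  rw [Metric.tendsto_nhds]
  intro ε hε
  have hs : TotallyBounded ((T : EllTwo →L[ℂ] EllTwo) '' Metric.closedBall 0 1) :=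
    (IsCompactOperator.isCompact_closure_image_closedBall
      (f := ((T : EllTwo →L[ℂ] EllTwo) : EllTwo →ₗ[ℂ] EllTwo))
        T.2 1).totallyBounded.subset subset_closure
  filter_upwards [hs.eventually_norm_sub_lt hP hlim (half_pos hε)] with F hF
  rw [dist_eq_norm]
  refine lt_of_le_of_lt ?_ (half_lt_self hε)
  change ‖((((∑ j ∈ F, thetaK j j) * T - T : CompactOps)) : EllTwo →L[ℂ] EllTwo)‖ ≤ ε / 2
  refine ContinuousLinearMap.opNorm_le_of_unit_norm (half_pos hε).le fun v hv => ?_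
  exact (hF _ ⟨v, by simp [hv], rfl⟩).le


/-- The matrix units of the algebra of compact operators. -/
noncomputable def compactUnits : RankOneUnits CompactOps where
  unit := thetaK
  isMatrixUnits := isMatrixUnits_thetaK
  ne_zero := thetaK_ne_zero
  entry := entryK
  mul_mul := thetaK_mul_mul
  tendsto_sum_mul := tendsto_sum_thetaK_mul

/-! ### Continuous functions with values in a C*-algebra with rank one matrix units -/

namespace RankOneUnits

variable {K : Type*} [NonUnitalCStarAlgebra K] (R : RankOneUnits K)

theorem entry_unit_same (i j : ℕ+) : R.entry i j (R.unit i j) = 1 := by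
  have h := R.mul_mul i j (R.unit i j)
  rw [R.isMatrixUnits.mul_same j j i, R.isMatrixUnits.mul_same j i i] at h
  refine smul_left_injective ℂ (R.ne_zero i j) ?_
  simp [← h]

theorem entry_unit_ne {i j k l : ℕ+} (h : ¬(k = i ∧ l = j)) : R.entry i j (R.unit k l) = 0 := by
  have h' := R.mul_mul i j (R.unit k l)
  have h0 : R.unit j j * R.unit k l * R.unit i i = 0 := by
    by_cases hl : j = l
    · rw [mul_assoc, R.isMatrixUnits.mul_ne (i := l) (l := i) fun hk : k = i => h ⟨hk, hl.symm⟩,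
        mul_zero]
    · rw [R.isMatrixUnits.mul_ne (i := j) (l := k) hl, zero_mul]
  rw [h0] at h'
  exact (smul_eq_zero.1 h'.symm).resolve_right (R.ne_zero i j)

variable {X : Type*} [TopologicalSpace X]

/-- The function `x ↦ g x • unit i j`. -/
noncomputable def mat (i j : ℕ+) : C(X, ℂ) →L[ℂ] C(X, K) :=
  (ContinuousLinearMap.toSpanSingleton ℂ (R.unit i j)).compLeftContinuous ℂ X

/-- The function `x ↦ f(x)_{j,i}`. -/
noncomputable def fnEntry (i j : ℕ+) : C(X, K) →L[ℂ] C(X, ℂ) :=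
  (R.entry i j).compLeftContinuous ℂ X

@[simp] theorem mat_apply (i j : ℕ+) (g : C(X, ℂ)) (x : X) : R.mat i j g x = g x • R.unit i j := rfl

@[simp] theorem fnEntry_apply (i j : ℕ+) (f : C(X, K)) (x : X) :
    R.fnEntry i j f x = R.entry i j (f x) := rfl

theorem mat_mul_same (i j k : ℕ+) (g g' : C(X, ℂ)) :
    R.mat j k g * R.mat i j g' = R.mat i k (g * g') := by
  ext1 x
  simp [smul_mul_smul_comm, R.isMatrixUnits.mul_same k j i]

theorem mat_mul_ne {i j k l : ℕ+} (h : k ≠ j) (g g' : C(X, ℂ)) :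
    R.mat k l g * R.mat i j g' = 0 := by
  ext1 x
  simp [smul_mul_smul_comm, R.isMatrixUnits.mul_ne (i := l) (l := i) h]

theorem star_mat (i j : ℕ+) (g : C(X, ℂ)) : star (R.mat i j g) = R.mat j i (star g) := by
  ext1 x
  simp [R.isMatrixUnits.star_eq j i]

theorem mat_mul_mul (i j : ℕ+) (f : C(X, K)) :
    R.mat j j 1 * f * R.mat i i 1 = R.mat i j (R.fnEntry i j f) := by
  ext1 x
  simpa using R.mul_mul i j (f x)

theorem fnEntry_mat_same (i j : ℕ+) (g : C(X, ℂ)) : R.fnEntry i j (R.mat i j g) = g := by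
  ext1 x
  simp [R.entry_unit_same]

theorem fnEntry_mat_ne {i j k l : ℕ+} (h : ¬(k = i ∧ l = j)) (g : C(X, ℂ)) :
    R.fnEntry i j (R.mat k l g) = 0 := by
  ext1 x
  simp [R.entry_unit_ne h]

theorem mat_injective (i j : ℕ+) : Function.Injective (R.mat (X := X) i j) :=
  Function.LeftInverse.injective (R.fnEntry_mat_same i j)

/-- The homomorphism `g ↦ mat i i g`. -/
noncomputable def matHom (i : ℕ+) : C(X, ℂ) →⋆ₙₐ[ℂ] C(X, K) where
  toFun := R.mat i i
  map_smul' c g := map_smul (R.mat i i) c g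
  map_zero' := map_zero (R.mat i i)
  map_add' g g' := map_add (R.mat i i) g g'
  map_mul' g g' := (R.mat_mul_same i i i g g').symm
  map_star' g := (R.star_mat i i g).symm

variable [CompactSpace X]

/-- The range of `f` is compact, so the diagonal projections converge to the identity uniformly on
it, that is, in the supremum norm. -/
theorem hasSum_mat_mul (f : C(X, K)) : HasSum (fun j => R.mat j j 1 * f) f := by
  change Tendsto _ _ _
  rw [SummationFilter.unconditional_filter, ContinuousMap.tendsto_iff_tendstoUniformly,
    Metric.tendstoUniformly_iff]
  intro ε hε
  let P : Finset ℕ+ → K →L[ℂ] K := fun F => ContinuousLinearMap.mul ℂ K (∑ j ∈ F, R.unit j j)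
  have hP : ∀ F, ‖P F‖ ≤ 1 := fun F => (ContinuousLinearMap.opNorm_mul_apply_le ℂ K _).trans
    (IsStarProjection.norm_le _ (R.isMatrixUnits.isStarProjection_sum F))
  have hs : TotallyBounded (Set.range f) := (isCompact_range f.continuous).totallyBounded
  filter_upwards [hs.eventually_norm_sub_lt hP R.tendsto_sum_mul hε] with F hF x
  rw [← Finset.sum_mul, dist_comm, dist_eq_norm]
  simpa [P, ContinuousMap.sum_apply, Finset.sum_mul] using hF _ ⟨x, rfl⟩

theorem hasSum_mul_mat (f : C(X, K)) : HasSum (fun j => f * R.mat j j 1) f := by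
  have h := (R.hasSum_mat_mul (star f)).star
  simpa [star_mat] using h

/-- A closed subspace that contains all corners of `f` contains `f`. -/
theorem mem_of_forall_mat_mem {W : Submodule ℂ C(X, K)} (hW : IsClosed (W : Set C(X, K)))
    {f : C(X, K)} (h : ∀ i j, R.mat i j (R.fnEntry i j f) ∈ W) : f ∈ W := by
  refine hW.mem_of_tendsto (R.hasSum_mat_mul f) (.of_forall fun F => W.sum_mem fun j _ => ?_)
  refine hW.mem_of_tendsto (R.hasSum_mul_mat _) (.of_forall fun F => W.sum_mem fun i _ => ?_)
  rw [mat_mul_mul]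
  exact h i j

theorem eq_zero_of_fnEntry {f : C(X, K)} (h : ∀ i j, R.fnEntry i j f = 0) : f = 0 := by
  have : f ∈ (⊥ : Submodule ℂ C(X, K)) :=
    R.mem_of_forall_mat_mem isClosed_singleton fun i j => by simp [h]
  simpa using this

/-- A closed subspace that contains all matrix units is everything. -/
theorem mem_of_forall_unit_mem {W : Submodule ℂ K} (hW : IsClosed (W : Set K))
    (h : ∀ i j, R.unit i j ∈ W) (T : K) : T ∈ W := by
  -- `K` is the algebra of `K`-valued functions on a point, so the result on corners of functions
  -- applies.
  let ev : C(Unit, K) →ₗ[ℂ] K :=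
    { toFun := fun f => f (), map_add' := fun _ _ => rfl, map_smul' := fun _ _ => rfl }
  have hev : Continuous ev := continuous_eval_const ()
  have : ContinuousMap.const Unit T ∈ W.comap ev :=
    R.mem_of_forall_mat_mem (hW.preimage hev) fun i j => W.smul_mem _ (h i j)
  exact this

theorem eq_zero_of_entry {T : K} (h : ∀ i j, R.entry i j T = 0) : T = 0 := by
  have : ContinuousMap.const Unit T = 0 := R.eq_zero_of_fnEntry fun i j => by
    ext x
    exact h i j
  exact congrArg (fun f : C(Unit, K) => f ()) this

end RankOneUnits

/-! ### Functions on the torus -/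

section torus

variable {X : Type*} [TopologicalSpace X] (h : X ≃ₜ Circle × Circle)

/-- The monomials `w^a z^b` on a torus. -/
noncomputable def mono (a b : ℤ) : C(X, ℂ) where
  toFun x := ((h x).1 ^ a * (h x).2 ^ b : Circle)
  continuous_toFun := continuous_subtype_val.comp <|
    ((continuous_fst.comp h.continuous).zpow a).mul ((continuous_snd.comp h.continuous).zpow b)

@[simp] theorem mono_apply (a b : ℤ) (x : X) :
    mono h a b x = ((h x).1 ^ a * (h x).2 ^ b : Circle) := rfl

theorem mono_zero : mono h 0 0 = 1 := by ext x; simp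

theorem mono_mul (a b c d : ℤ) : mono h a b * mono h c d = mono h (a + c) (b + d) := by
  ext x
  simp only [ContinuousMap.mul_apply, mono_apply, ← Circle.coe_mul, zpow_add]
  congr 1
  exact mul_mul_mul_comm _ _ _ _

theorem star_mono (a b : ℤ) : star (mono h a b) = mono h (-a) (-b) := by
  ext x
  simp only [ContinuousMap.star_apply, mono_apply, Complex.star_def, ← Circle.coe_inv_eq_conj,
    mul_inv, zpow_neg]

variable [CompactSpace X]

/-- Stone–Weierstrass: the monomials are closed under products and adjoints, so the star-algebra
they generate is their linear span, and the two coordinates separate points. -/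
theorem closure_span_mono :
    (Submodule.span ℂ (Set.range fun p : ℤ × ℤ => mono h p.1 p.2)).topologicalClosure = ⊤ := by
  let M : Submonoid C(X, ℂ) :=
    { carrier := Set.range fun p : ℤ × ℤ => mono h p.1 p.2
      one_mem' := ⟨0, mono_zero h⟩
      mul_mem' := by
        rintro _ _ ⟨p, rfl⟩ ⟨q, rfl⟩
        exact ⟨p + q, (mono_mul h _ _ _ _).symm⟩ }
  let N : StarSubalgebra ℂ C(X, ℂ) :=
    { Algebra.adjoin ℂ (M : Set C(X, ℂ)) with
      star_mem' := by
        intro g hg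
        change g ∈ Algebra.adjoin ℂ (M : Set C(X, ℂ)) at hg
        change star g ∈ Algebra.adjoin ℂ (M : Set C(X, ℂ))
        induction hg using Algebra.adjoin_induction with
        | mem x hx =>
          obtain ⟨p, rfl⟩ := hx
          exact Algebra.subset_adjoin ⟨-p, (star_mono h _ _).symm⟩
        | algebraMap r =>
          rw [← algebraMap_star_comm]
          exact Subalgebra.algebraMap_mem _ _
        | add x y _ _ hx hy => rw [star_add]; exact add_mem hx hy
        | mul x y _ _ hx hy => rw [star_mul]; exact mul_mem hy hx }
  have hN : N.topologicalClosure = ⊤ := by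
    refine ContinuousMap.starSubalgebra_topologicalClosure_eq_top_of_separatesPoints N ?_
    intro x y hxy
    have hmem : ∀ p : ℤ × ℤ, mono h p.1 p.2 ∈ N := fun p => Algebra.subset_adjoin ⟨p, rfl⟩
    by_cases h1 : (h x).1 = (h y).1
    · refine ⟨_, ⟨_, hmem (0, 1), rfl⟩, fun h2 => hxy (h.injective (Prod.ext h1 ?_))⟩
      exact Circle.ext (by simpa using h2)
    · refine ⟨_, ⟨_, hmem (1, 0), rfl⟩, fun h2 => h1 ?_⟩
      exact Circle.ext (by simpa using h2)
  have hs : Subalgebra.toSubmodule (Algebra.adjoin ℂ (M : Set C(X, ℂ)))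
      = Submodule.span ℂ (M : Set C(X, ℂ)) := by
    rw [Algebra.adjoin_eq_span, Submonoid.closure_eq]
  rw [eq_top_iff]
  intro g _
  have hg : g ∈ N.topologicalClosure := hN ▸ StarSubalgebra.mem_top
  change g ∈ closure (Submodule.span ℂ (M : Set C(X, ℂ)) : Set C(X, ℂ))
  rw [← hs]
  exact hg

/-- Induction principle for continuous functions on the torus. -/
theorem mem_of_forall_mono_mem {N : Submodule ℂ C(X, ℂ)} (hN : IsClosed (N : Set C(X, ℂ)))
    (hm : ∀ a b, mono h a b ∈ N) (g : C(X, ℂ)) : g ∈ N := by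
  have hle : (Submodule.span ℂ (Set.range fun p : ℤ × ℤ => mono h p.1 p.2)).topologicalClosure
      ≤ N := Submodule.topologicalClosure_minimal _
    (Submodule.span_le.2 (by rintro _ ⟨p, rfl⟩; exact hm p.1 p.2)) hN
  exact hle (closure_span_mono h ▸ Submodule.mem_top)

omit [CompactSpace X] in
theorem mono_mem {N : NonUnitalStarSubalgebra ℂ C(X, ℂ)} (h1 : 1 ∈ N) (hw : mono h 1 0 ∈ N)
    (hz : mono h 0 1 ∈ N) (a b : ℤ) : mono h a b ∈ N := by
  have hw' : mono h (-1) 0 ∈ N := by simpa [star_mono] using star_mem hw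
  have hz' : mono h 0 (-1) ∈ N := by simpa [star_mono] using star_mem hz
  have hb : ∀ b : ℤ, mono h 0 b ∈ N := fun b => by
    induction b using Int.induction_on with
    | zero => rwa [mono_zero]
    | succ i hi => simpa [mono_mul] using mul_mem hi hz
    | pred i hi => simpa [mono_mul, sub_eq_add_neg] using mul_mem hi hz'
  induction a using Int.induction_on with
  | zero => exact hb b
  | succ i hi => simpa [mono_mul] using mul_mem hi hw
  | pred i hi => simpa [mono_mul, sub_eq_add_neg] using mul_mem hi hw'

theorem mem_of_coord_mem {N : NonUnitalStarSubalgebra ℂ C(X, ℂ)} (hN : IsClosed (N : Set C(X, ℂ)))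
    (h1 : 1 ∈ N) (hw : mono h 1 0 ∈ N) (hz : mono h 0 1 ∈ N) (g : C(X, ℂ)) : g ∈ N :=
  mem_of_forall_mono_mem h (N := N.toSubmodule) hN (mono_mem h h1 hw hz) g

end torus

/-! ### Functional calculus for two commuting unitaries -/

section calculus

variable {X : Type*} [TopologicalSpace X] [CompactSpace X] (h : X ≃ₜ Circle × Circle)

theorem mem_sphere_of_mem_unitary {A : Type*} [CommCStarAlgebra A] {a : A} (ha : a ∈ unitary A)
    (χ : WeakDual.characterSpace ℂ A) : χ a ∈ Submonoid.unitSphere ℂ := by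
  have h1 : star (χ a) * χ a = 1 := by rw [← map_star, ← map_mul, ha.1, map_one]
  rw [Submonoid.unitSphere, ← SetLike.mem_coe]
  have h2 : ‖χ a‖ * ‖χ a‖ = 1 := by simpa using congrArg norm h1
  simpa using (mul_self_eq_one_iff.1 h2).resolve_right
    (by linarith [norm_nonneg (χ a)])

/-- The value of a character at a unitary. -/
noncomputable def charCircle {A : Type*} [CommCStarAlgebra A] {a : A} (ha : a ∈ unitary A)
    (χ : WeakDual.characterSpace ℂ A) : Circle := ⟨χ a, mem_sphere_of_mem_unitary ha χ⟩

@[simp] theorem coe_charCircle {A : Type*} [CommCStarAlgebra A] {a : A} (ha : a ∈ unitary A)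
    (χ : WeakDual.characterSpace ℂ A) : (charCircle ha χ : ℂ) = χ a := rfl

omit [CompactSpace X] in
-- A character `χ` gives the point `(χ a, χ b)` of the torus. Pulling functions back along this map
-- and inverting the Gelfand transform gives the calculus. The joint spectrum need not be known.
theorem exists_calculus_of_comm {A : Type*} [CommCStarAlgebra A] {a b : A} (ha : a ∈ unitary A)
    (hb : b ∈ unitary A) :
    ∃ φ : C(X, ℂ) →⋆ₐ[ℂ] A, φ (mono h 1 0) = a ∧ φ (mono h 0 1) = b := by
  let κ : C(WeakDual.characterSpace ℂ A, X) :=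
    { toFun := fun χ => h.symm
        (charCircle ha χ, charCircle hb χ)
      continuous_toFun := by
        have hc : ∀ c : A, Continuous fun χ : WeakDual.characterSpace ℂ A => χ c := fun c =>
          (map_continuous (WeakDual.gelfandTransform ℂ A c))
        exact h.symm.continuous.comp (((hc a).subtype_mk _).prodMk ((hc b).subtype_mk _)) }
  refine ⟨((gelfandStarTransform A).symm : _ →⋆ₐ[ℂ] A).comp (κ.compStarAlgHom' ℂ ℂ), ?_, ?_⟩
  all_goals
    change (gelfandStarTransform A).symm _ = _
    rw [StarAlgEquiv.symm_apply_eq]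
    ext χ
    change ((_ ^ _ * _ ^ _ : Circle) : ℂ) = χ _
    simp [κ]

omit [CompactSpace X] in
theorem exists_calculus {A : Type*} [CStarAlgebra A] {a b : A} (ha : a ∈ unitary A)
    (hb : b ∈ unitary A) (hab : Commute a b) :
    ∃ φ : C(X, ℂ) →⋆ₐ[ℂ] A, φ (mono h 1 0) = a ∧ φ (mono h 0 1) = b := by
  have hna : IsStarNormal a := ⟨by rw [Commute, SemiconjBy, ha.1, ha.2]⟩
  have hnb : IsStarNormal b := ⟨by rw [Commute, SemiconjBy, hb.1, hb.2]⟩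
  let S : StarSubalgebra ℂ A := (StarAlgebra.adjoin ℂ {a, b}).topologicalClosure
  have hS : IsClosed (S : Set A) := (StarAlgebra.adjoin ℂ {a, b}).isClosed_topologicalClosure
  have hc : IsMulCommutative (StarAlgebra.adjoin ℂ ({a, b} : Set A)) := by
    -- An element that commutes with a normal element commutes with its adjoint, so the star-algebra
    -- generated by `a` and `b` is commutative.
    have h1 := hna.commute_star_left hab
    have h2 := hnb.commute_star_right hab
    exact StarAlgebra.isMulCommutative_adjoin ℂ (by grind) (by grind [commute_star_comm])
  let _ : CommRing S := StarSubalgebra.commRingTopologicalClosure _ fun x y => hc.is_comm.comm x y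
  let _ : CommCStarAlgebra S := { }
  have hmem : ∀ c ∈ ({a, b} : Set A), c ∈ S := fun c hc =>
    StarSubalgebra.le_topologicalClosure _ (StarAlgebra.subset_adjoin ℂ _ hc)
  obtain ⟨φ, h1, h2⟩ := exists_calculus_of_comm h (A := S) (a := ⟨a, hmem a (by simp)⟩)
    (b := ⟨b, hmem b (by simp)⟩) ⟨Subtype.ext ha.1, Subtype.ext ha.2⟩
    ⟨Subtype.ext hb.1, Subtype.ext hb.2⟩
  refine ⟨S.subtype.comp φ, ?_, ?_⟩
  · change S.subtype (φ _) = a; rw [h1]; rfl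
  · change S.subtype (φ _) = b; rw [h2]; rfl

/-- The functional calculus of two commuting unitaries in the corner of a projection `p`. -/
theorem exists_corner_calculus {A : Type*} [NonUnitalCStarAlgebra A] {p a b : A}
    (hp : IsStarProjection p) (ha : star a * a = p) (ha' : a * star a = p)
    (hb : star b * b = p) (hb' : b * star b = p) (hab : a * b = b * a) :
    ∃ φ : C(X, ℂ) →⋆ₙₐ[ℂ] A, φ 1 = p ∧ φ (mono h 1 0) = a ∧ φ (mono h 0 1) = b := by
  let ι := Unitization.inrNonUnitalStarAlgHom ℂ A
  have hι : Function.Injective ι := Unitization.inr_injective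
  have hpp : p * p = p := hp.isIdempotentElem
  have hps : star p = p := hp.isSelfAdjoint
  -- The product `star (c * p - c) * (c * p - c)` expands to zero because `star c * c = p`. Then `p
  -- * c = c * star c * c = c * p = c`.
  have key : ∀ c : A, star c * c = p → c * star c = p →
      c * p = c ∧ p * c = c := fun c h1 h2 => by
    have hc : c * p = c := by
      have : star (c * p - c) * (c * p - c) = 0 := by
        simp only [star_sub, star_mul, hps, sub_mul, mul_sub, mul_assoc]
        rw [← mul_assoc (star c) c p, h1]
        simp [hpp]
      exact sub_eq_zero.1 ((CStarRing.star_mul_self_eq_zero_iff _).1 this)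
    exact ⟨hc, by rw [← h2, mul_assoc, h1, hc]⟩
  obtain ⟨hap, hpa⟩ := key a ha ha'
  obtain ⟨hbp, hpb⟩ := key b hb hb'
  have hsap : star a * p = star a := by rw [← hps, ← star_mul, hpa]
  have hpsa : p * star a = star a := by rw [← hps, ← star_mul, hap]
  have hsbp : star b * p = star b := by rw [← hps, ← star_mul, hpb]
  have hpsb : p * star b = star b := by rw [← hps, ← star_mul, hbp]
  -- Adding `1 - p` turns a unitary of the corner into a unitary of the unitization.
  let E : A → Unitization ℂ A := fun c => ι c + (1 - ι p)
  have hE : ∀ c d : A, c * p = c → p * d = d → E c * E d = E (c * d) := fun c d hc hd => by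
    have h1 : ι c * ι p = ι c := by rw [← map_mul, hc]
    have h2 : ι p * ι d = ι d := by rw [← map_mul, hd]
    have h3 : ι p * ι p = ι p := by rw [← map_mul, hpp]
    simp only [E, add_mul, mul_add, mul_sub, sub_mul, mul_one, one_mul, h1, h2, h3, map_mul]
    abel
  have hEs : ∀ c : A, star (E c) = E (star c) := fun c => by
    simp only [E, star_add, star_sub, star_one, ← map_star, hps]
  have hEp : E p = 1 := by simp [E]
  have hEu : ∀ c : A, c * p = c → p * c = c → star c * p = star c → p * star c = star c →
      star c * c = p → c * star c = p → E c ∈ unitary (Unitization ℂ A) :=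
    fun c h1 h2 h3 h4 h5 h6 => by
      rw [Unitary.mem_iff, hEs, hE _ _ h3 h2, hE _ _ h1 h4, h5, h6, hEp, and_self]
  have hcomm : Commute (E a) (E b) := by
    rw [Commute, SemiconjBy, hE _ _ hap hpb, hE _ _ hbp hpa, hab]
  obtain ⟨φ, hφa, hφb⟩ := exists_calculus h (hEu a hap hpa hsap hpsa ha ha')
    (hEu b hbp hpb hsbp hpsb hb hb') hcomm
  have hpE : ∀ c : A, p * c = c → ι p * E c = ι c := fun c hc => by
    have h2 : ι p * ι c = ι c := by rw [← map_mul, hc]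
    have h3 : ι p * ι p = ι p := by rw [← map_mul, hpp]
    simp [E, mul_add, mul_sub, h2, h3]
  have hEp' : ∀ c : A, c * p = c → E c * ι p = ι c := fun c hc => by
    have h2 : ι c * ι p = ι c := by rw [← map_mul, hc]
    have h3 : ι p * ι p = ι p := by rw [← map_mul, hpp]
    simp [E, add_mul, sub_mul, h2, h3]
  -- The functions whose image commutes with `p` form a closed star-algebra containing `1` and the
  -- coordinates. This commutation makes cutting down by `p` multiplicative.
  have hφp : ∀ g, ι p * φ g = φ g * ι p := by
    let N : NonUnitalStarSubalgebra ℂ C(X, ℂ) :=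
      { carrier := {g | ι p * φ g = φ g * ι p}
        add_mem' := fun {f g} hf hg => by
          change _ * φ _ = _
          rw [map_add, mul_add, add_mul, hf, hg]
        zero_mem' := by simp
        mul_mem' := fun {f g} hf hg => by
          change _ * φ _ = _
          change _ * φ _ = _ at hf
          change _ * φ _ = _ at hg
          rw [map_mul, ← mul_assoc, hf, mul_assoc, hg, mul_assoc]
        smul_mem' := fun c g hg => by
          change _ * φ _ = _
          change _ * φ _ = _ at hg
          rw [map_smul, mul_smul_comm, hg, smul_mul_assoc]
        star_mem' := fun {g} hg => by
          change _ * φ _ = _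
          change _ * φ _ = _ at hg
          have := congrArg star hg
          rw [star_mul, star_mul, ← map_star φ, ← map_star ι, hps] at this
          exact this.symm }
    have hcont : Continuous φ := continuous_starHom (φ : C(X, ℂ) →⋆ₙₐ[ℂ] Unitization ℂ A)
    refine mem_of_coord_mem h (N := N)
      (isClosed_eq (continuous_const.mul hcont) (hcont.mul continuous_const)) ?_ ?_ ?_
    · change _ * φ _ = _
      rw [map_one, mul_one, one_mul]
    · change _ * φ _ = _
      rw [hφa, hpE a hpa, hEp' a hap]
    · change _ * φ _ = _
      rw [hφb, hpE b hpb, hEp' b hbp]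
  -- `A` is an ideal of its unitization, so multiplication by `p` lands in `A`.
  have hex : ∀ g, ∃ c : A, ι c = ι p * φ g := fun g => by
    refine ⟨(ι p * φ g).snd, Unitization.ext ?_ ?_⟩
    · simp [ι]
    · simp [ι]
  choose ψ hψ using hex
  have hιp : ι p * ι p = ι p := by rw [← map_mul, hpp]
  refine ⟨{ toFun := ψ, map_smul' := ?_, map_zero' := ?_, map_add' := ?_, map_mul' := ?_,
            map_star' := ?_ }, hι ?_, hι ?_, hι ?_⟩
  · intro c g
    apply hι
    simp only [hψ, map_smul, mul_smul_comm, MonoidHom.id_apply]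
  · apply hι
    simp [hψ]
  · intro f g
    apply hι
    simp only [hψ, map_add, mul_add]
  · intro f g
    apply hι
    calc ι (ψ (f * g)) = ι p * ι p * φ f * φ g := by rw [hψ, hιp, map_mul φ, mul_assoc]
      _ = ι p * φ f * (ι p * φ g) := by
          rw [mul_assoc (ι p) (ι p) (φ f), hφp f, ← mul_assoc (ι p) (φ f), hφp f, mul_assoc]
      _ = ι (ψ f * ψ g) := by rw [map_mul ι, hψ, hψ]
  · intro g
    apply hι
    rw [map_star ι, hψ, hψ, star_mul, ← map_star ι, hps, ← map_star φ, ← hφp]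
  · change ι (ψ 1) = _
    rw [hψ, map_one, mul_one]
  · change ι (ψ _) = _
    rw [hψ, hφa, hpE a hpa]
  · change ι (ψ _) = _
    rw [hψ, hφb, hpE b hpb]

end calculus

/-! ### The universal property of `C(X, K)` -/

/-- The C*-algebra generated by a star-closed semigroup is its closed linear span. -/
theorem mem_of_mem_closure_adjoin {A : Type*} [NonUnitalCStarAlgebra A] {s : Set A}
    (hmul : ∀ x ∈ s, ∀ y ∈ s, x * y ∈ s) (hstar : ∀ x ∈ s, star x ∈ s) {N : Submodule ℂ A}
    (hN : IsClosed (N : Set A)) (hs : s ⊆ N) {c : A}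
    (hc : c ∈ (NonUnitalStarAlgebra.adjoin ℂ s).topologicalClosure) : c ∈ N := by
  have h1 : (NonUnitalStarAlgebra.adjoin ℂ s).toSubmodule ≤ N := by
    rw [NonUnitalStarAlgebra.adjoin_eq_span, Submodule.span_le]
    refine subset_trans ?_ hs
    let M : Subsemigroup A := { carrier := s, mul_mem' := fun hx hy => hmul _ hx _ hy }
    have h2 : Subsemigroup.closure (s ∪ star s) ≤ M := by
      rw [Subsemigroup.closure_le]
      rintro x (hx | hx)
      · exact hx
      · have h := hstar _ hx
        rwa [star_star] at h
    exact h2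
  exact hN.closure_subset_iff.2 h1 hc

section universal

variable {X K A : Type*} [TopologicalSpace X] [CompactSpace X] [NonUnitalCStarAlgebra K]
  [NonUnitalCStarAlgebra A] (R : RankOneUnits K) {E : ℕ+ → ℕ+ → A} {n : ℕ+}

namespace IsMatrixUnits

omit [CompactSpace X] in
theorem calculus_mul_unit {g : C(X, ℂ)} {φ : C(X, ℂ) →⋆ₙₐ[ℂ] A} (hφ : φ 1 = E n n) :
    φ g * E n n = φ g := by
  rw [← hφ, ← map_mul, mul_one]

omit [CompactSpace X] in
theorem unit_mul_calculus {g : C(X, ℂ)} {φ : C(X, ℂ) →⋆ₙₐ[ℂ] A} (hφ : φ 1 = E n n) :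
    E n n * φ g = φ g := by
  rw [← hφ, ← map_mul, one_mul]

omit [CompactSpace X] in
theorem corner_mul_same (hE : IsMatrixUnits (fun j i => E i j)) {φ : C(X, ℂ) →⋆ₙₐ[ℂ] A}
    (hφ : φ 1 = E n n) (i j k : ℕ+) (g g' : C(X, ℂ)) :
    (E n k * φ g * E j n) * (E n j * φ g' * E i n) = E n k * φ (g * g') * E i n := by
  have h : E j n * E n j = E n n := hE.mul_same n j n
  calc (E n k * φ g * E j n) * (E n j * φ g' * E i n)
      = E n k * (φ g * (E j n * E n j)) * φ g' * E i n := by simp only [mul_assoc]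
    _ = E n k * φ (g * g') * E i n := by
      rw [h, calculus_mul_unit hφ, map_mul, ← mul_assoc]

omit [CompactSpace X] in
theorem corner_mul_ne (hE : IsMatrixUnits (fun j i => E i j)) {φ : C(X, ℂ) →⋆ₙₐ[ℂ] A}
    {i j k l : ℕ+} (hjk : k ≠ j) (g g' : C(X, ℂ)) :
    (E n l * φ g * E k n) * (E n j * φ g' * E i n) = 0 := by
  have h : E k n * E n j = 0 := hE.mul_ne (i := n) (l := n) hjk
  calc (E n l * φ g * E k n) * (E n j * φ g' * E i n)
      = E n l * φ g * (E k n * E n j) * φ g' * E i n := by simp only [mul_assoc]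
    _ = 0 := by rw [h]; simp

omit [CompactSpace X] in
theorem star_corner (hE : IsMatrixUnits (fun j i => E i j)) (φ : C(X, ℂ) →⋆ₙₐ[ℂ] A)
    (i j : ℕ+) (g : C(X, ℂ)) :
    star (E n j * φ g * E i n) = E n i * φ (star g) * E j n := by
  rw [star_mul, star_mul, hE.star_eq n i, hE.star_eq j n, map_star, mul_assoc]

/-- The graph of the homomorphism of `exists_hom`. -/
def graphGenerators (E : ℕ+ → ℕ+ → A) (n : ℕ+) (φ : C(X, ℂ) →⋆ₙₐ[ℂ] A) : Set (A × C(X, K)) :=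
  {x | ∃ i j g, x = (E n j * φ g * E i n, R.mat i j g)}

/-- Products and adjoints of generating pairs are again generating pairs. The closed star-algebra
they generate is thus their closed linear span, and continuous linear identities need checking on
generators only. -/
theorem mem_of_mem_graph (hE : IsMatrixUnits (fun j i => E i j)) {φ : C(X, ℂ) →⋆ₙₐ[ℂ] A}
    (hφ : φ 1 = E n n) {N : Submodule ℂ (A × C(X, K))} (hN : IsClosed (N : Set (A × C(X, K))))
    (h : ∀ i j g, (E n j * φ g * E i n, R.mat i j g) ∈ N) {c : A × C(X, K)}
    (hc : c ∈ (NonUnitalStarAlgebra.adjoin ℂ (graphGenerators R E n φ)).topologicalClosure) :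
    c ∈ N := by
  refine mem_of_mem_closure_adjoin ?_ ?_ hN ?_ hc
  · rintro _ ⟨j', k, g, rfl⟩ _ ⟨i, j, g', rfl⟩
    by_cases hj : j' = j
    · subst hj
      exact ⟨i, k, g * g', by rw [Prod.mk_mul_mk, hE.corner_mul_same hφ, R.mat_mul_same]⟩
    -- A vanishing product is the generating pair of the function `0`; the indices are arbitrary.
    · exact ⟨n, n, 0, by rw [Prod.mk_mul_mk, hE.corner_mul_ne hj, R.mat_mul_ne hj]; simp⟩
  · rintro _ ⟨i, j, g, rfl⟩
    exact ⟨j, i, star g, by rw [Prod.star_def, hE.star_corner, R.star_mat]⟩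
  · rintro _ ⟨i, j, g, rfl⟩
    exact h i j g

/-- Both sides are continuous and linear in `c`, so generators suffice. The point is that the second
component of a pair determines every corner of the first. -/
theorem corner_eq_of_mem_graph (hE : IsMatrixUnits (fun j i => E i j)) {φ : C(X, ℂ) →⋆ₙₐ[ℂ] A}
    (hφ : φ 1 = E n n) {c : A × C(X, K)}
    (hc : c ∈ (NonUnitalStarAlgebra.adjoin ℂ (graphGenerators R E n φ)).topologicalClosure)
    (i j : ℕ+) : E j n * c.1 * E n i = φ (R.fnEntry i j c.2) := by
  have hcont : Continuous φ := continuous_starHom φ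
  let L : A × C(X, K) →ₗ[ℂ] A :=
    LinearMap.mulRight ℂ (E n i) ∘ₗ LinearMap.mulLeft ℂ (E j n) ∘ₗ LinearMap.fst ℂ A C(X, K)
  let L' : A × C(X, K) →ₗ[ℂ] A :=
    (φ : C(X, ℂ) →ₗ[ℂ] A) ∘ₗ (R.fnEntry i j).toLinearMap ∘ₗ LinearMap.snd ℂ A C(X, K)
  have hL : Continuous L := (continuous_const.mul continuous_fst).mul continuous_const
  have hL' : Continuous L' := hcont.comp ((R.fnEntry i j).continuous.comp continuous_snd)
  refine hE.mem_of_mem_graph R hφ (N := LinearMap.eqLocus L L') (isClosed_eq hL hL') ?_ hc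
  intro k l g
  change E j n * (E n l * φ g * E k n) * E n i = φ (R.fnEntry i j (R.mat k l g))
  by_cases h : k = i ∧ l = j
  · obtain ⟨rfl, rfl⟩ := h
    have h1 : E l n * E n l = E n n := hE.mul_same n l n
    have h2 : E k n * E n k = E n n := hE.mul_same n k n
    rw [R.fnEntry_mat_same, ← mul_assoc, ← mul_assoc, h1, mul_assoc, h2, unit_mul_calculus hφ,
      calculus_mul_unit hφ]
  · rw [R.fnEntry_mat_ne h, map_zero]
    by_cases hl : j = l
    · have h2 : E k n * E n i = 0 :=
        hE.mul_ne (i := n) (l := n) fun hk : k = i => h ⟨hk, hl.symm⟩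
      rw [mul_assoc, mul_assoc, h2, mul_zero, mul_zero]
    · have h1 : E j n * E n l = 0 := hE.mul_ne (i := n) (l := n) hl
      rw [← mul_assoc, ← mul_assoc, h1]
      simp

/-- This makes the relation single-valued as a map from `C(X, K)` to `A`. If `c.2 = 0`, all corners
of `c.1` vanish, but the `E j j` need not add up to the identity of `A`. However, if `b * E k k = 0`
for all `k`, then `b` annihilates all first components from the left. Using this twice gives `c.1 *
star c.1 * c.1 = 0`. -/
theorem fst_eq_zero_of_mem_graph (hE : IsMatrixUnits (fun j i => E i j))
    {φ : C(X, ℂ) →⋆ₙₐ[ℂ] A} (hφ : φ 1 = E n n) {c : A × C(X, K)}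
    (hc : c ∈ (NonUnitalStarAlgebra.adjoin ℂ (graphGenerators R E n φ)).topologicalClosure)
    (hc2 : c.2 = 0) : c.1 = 0 := by
  have hzero : ∀ b : A, (∀ k, b * E k k = 0) → ∀ y ∈
      (NonUnitalStarAlgebra.adjoin ℂ (graphGenerators R E n φ)).topologicalClosure,
      b * y.1 = 0 := by
    intro b hb y hy
    let L : A × C(X, K) →ₗ[ℂ] A := LinearMap.mulLeft ℂ b ∘ₗ LinearMap.fst ℂ A C(X, K)
    have hL : Continuous L := continuous_const.mul continuous_fst
    refine hE.mem_of_mem_graph R hφ (N := LinearMap.ker L) (isClosed_eq hL continuous_const) ?_ hy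
    intro i j g
    change b * (E n j * φ g * E i n) = 0
    have h1 : E j j * E n j = E n j := hE.mul_same j j n
    rw [← h1, ← mul_assoc, ← mul_assoc, ← mul_assoc, hb]
    simp
  have h1 : ∀ j i, E j j * c.1 * E i i = 0 := fun j i => by
    have h2 := hE.corner_eq_of_mem_graph R hφ hc i j
    have h3 : E n j * E j n = E j j := hE.mul_same j n j
    have h4 : E n i * E i n = E i i := hE.mul_same i n i
    calc E j j * c.1 * E i i = E n j * (E j n * c.1 * E n i) * E i n := by
          rw [← h3, ← h4]; simp only [mul_assoc]
      _ = 0 := by rw [h2, hc2, map_zero, map_zero, mul_zero, zero_mul]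
  have h2 : ∀ j, E j j * c.1 * star c.1 = 0 := fun j => hzero _ (h1 j) (star c) (star_mem hc)
  have h3 : ∀ j, c.1 * star c.1 * E j j = 0 := fun j => by
    have := congrArg star (h2 j)
    rwa [star_mul, star_mul, star_star, hE.star_eq j j, star_zero, ← mul_assoc] at this
  have h4 : c.1 * star c.1 * c.1 = 0 := hzero _ h3 c hc
  have h5 : star (star c.1 * c.1) * (star c.1 * c.1) = 0 := by
    rw [star_mul, star_star, mul_assoc, ← mul_assoc c.1, h4, mul_zero]
  exact (CStarRing.star_mul_self_eq_zero_iff _).1 ((CStarRing.star_mul_self_eq_zero_iff _).1 h5)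

/-- Matrix units `E` in a C*-algebra `A` together with a unital representation of `C(X)` in the
corner of `E n n` define a representation of `C(X, K)`. -/
theorem exists_hom (hE : IsMatrixUnits (fun j i => E i j)) {φ : C(X, ℂ) →⋆ₙₐ[ℂ] A}
    (hφ : φ 1 = E n n) :
    ∃ Ψ : C(X, K) →⋆ₙₐ[ℂ] A, ∀ i j g, Ψ (R.mat i j g) = E n j * φ g * E i n := by
  let C : NonUnitalStarSubalgebra ℂ (A × C(X, K)) :=
    (NonUnitalStarAlgebra.adjoin ℂ (graphGenerators R E n φ)).topologicalClosure
  have hC : IsClosed (C : Set (A × C(X, K))) :=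
    NonUnitalStarSubalgebra.isClosed_topologicalClosure _
  let q : C →⋆ₙₐ[ℂ] C(X, K) :=
    (NonUnitalStarAlgHom.snd ℂ A C(X, K)).comp (NonUnitalStarSubalgebraClass.subtype C)
  have hq : Function.Injective q := by
    rw [injective_iff_map_eq_zero]
    intro c hc
    exact Subtype.ext (Prod.ext (hE.fst_eq_zero_of_mem_graph R hφ c.2 hc) hc)
  -- An injective homomorphism of C*-algebras is isometric, so its range is closed; it contains all
  -- corners and hence everything.
  have hqi : Isometry q := AddMonoidHomClass.isometry_of_norm q (NonUnitalStarAlgHom.norm_map q hq)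
  have hmem : ∀ i j g, (E n j * φ g * E i n, R.mat i j g) ∈ C := fun i j g =>
    NonUnitalStarSubalgebra.le_topologicalClosure _
      (NonUnitalStarAlgebra.subset_adjoin ℂ _ ⟨i, j, g, rfl⟩)
  have hqs : Function.Surjective q := fun f => by
    have hf : f ∈ LinearMap.range (q : C →ₗ[ℂ] C(X, K)) :=
      R.mem_of_forall_mat_mem hqi.isClosedEmbedding.isClosed_range fun i j =>
        ⟨⟨_, hmem i j (R.fnEntry i j f)⟩, rfl⟩
    exact hf
  let e : C ≃⋆ₐ[ℂ] C(X, K) := StarAlgEquiv.ofBijective q ⟨hq, hqs⟩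
  refine ⟨((NonUnitalStarAlgHom.fst ℂ A C(X, K)).comp
    (NonUnitalStarSubalgebraClass.subtype C)).comp (e.symm : C(X, K) →⋆ₙₐ[ℂ] C), fun i j g => ?_⟩
  have h : e.symm (R.mat i j g) = ⟨_, hmem i j g⟩ := by
    rw [StarAlgEquiv.symm_apply_eq]; rfl
  change ((e.symm (R.mat i j g) : C) : A × C(X, K)).1 = _
  rw [h]

/-- Matrix units in a C*-algebra define a representation of `K`. -/
theorem exists_hom_of_units (hE : IsMatrixUnits (fun j i => E i j)) :
    ∃ Ψ : K →⋆ₙₐ[ℂ] A, ∀ i j, Ψ (R.unit i j) = E i j := by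
  -- Over a one-point space the corner calculus consists of the scalar multiples of `E 1 1`.
  let φ : C(Unit, ℂ) →⋆ₙₐ[ℂ] A :=
    { toFun := fun g => g () • E 1 1
      map_smul' := fun c g => smul_assoc c (g ()) (E 1 1)
      map_zero' := zero_smul ℂ (E 1 1)
      map_add' := fun f g => add_smul (f ()) (g ()) (E 1 1)
      map_mul' := fun f g => by
        have h : E 1 1 * E 1 1 = E 1 1 := hE.mul_same 1 1 1
        rw [smul_mul_smul_comm, h]
        rfl
      map_star' := fun g => by
        rw [star_smul, hE.star_eq 1 1]
        rfl }
  obtain ⟨Ψ, hΨ⟩ := hE.exists_hom R (φ := φ) (n := 1) (one_smul ℂ (E 1 1))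
  let κ : K →⋆ₙₐ[ℂ] C(Unit, K) :=
    { toFun := ContinuousMap.const Unit
      map_smul' := fun _ _ => rfl
      map_zero' := rfl
      map_add' := fun _ _ => rfl
      map_mul' := fun _ _ => rfl
      map_star' := fun _ => rfl }
  refine ⟨Ψ.comp κ, fun i j => ?_⟩
  have h1 : κ (R.unit i j) = R.mat i j 1 := by
    ext1 x
    exact (one_smul ℂ _).symm
  have h2 : E 1 j * E 1 1 = E 1 j := hE.mul_same j 1 1
  have h3 : E 1 j * E i 1 = E i j := hE.mul_same j 1 i
  change Ψ (κ (R.unit i j)) = E i j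
  rw [h1, hΨ]
  change E 1 j * ((1 : ℂ) • E 1 1) * E i 1 = E i j
  rw [one_smul, h2, h3]

end IsMatrixUnits

end universal

/-! ### Paths in `Λ_n` -/

namespace LambdaN

variable {n : ℕ+}

/-- Every path can be prolonged at its source by the degree missing to `d`, so maximality forces
degree `d`. -/
theorem mem_pathsLE_iff {v : LambdaN n} {d : Fin 2 → ℕ} {l : KGraph.PathsTo v} :
    l ∈ KGraph.pathsLE v d ↔ KGraph.deg l.2 = d := by
  constructor
  · rintro ⟨hle, hmax⟩
    let μ : KGraph.PathsTo l.1 := ⟨_, (Path.mk (d - KGraph.deg l.2) rfl : Path _ l.1)⟩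
    have h1 : KGraph.deg (μ.2 ≫ l.2) = d := by
      rw [KGraph.deg_comp]
      exact add_tsub_cancel_of_le hle
    have h2 := congrArg (fun p : KGraph.PathsTo l.1 => KGraph.deg p.2) (hmax μ h1.le)
    have h3 : KGraph.deg μ.2 = 0 := h2
    rw [KGraph.deg_comp, h3, add_zero] at h1
    exact h1
  · rintro rfl
    refine ⟨le_rfl, fun μ hμ => (existsUnique_path l.1 0).unique ?_ rfl⟩
    rw [KGraph.deg_comp] at hμ
    funext i
    have := hμ i
    simp only [Pi.add_apply] at this
    simp only [Pi.zero_apply]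
    omega

theorem finsum_pathsLE {A : Type*} [AddCommMonoid A] {v : LambdaN n} (d : Fin 2 → ℕ)
    (G : KGraph.PathsTo v → A) {l : KGraph.PathsTo v} (hl : KGraph.deg l.2 = d) :
    ∑ᶠ p : KGraph.pathsLE v d, G p.1 = G l := by
  refine finsum_eq_single (fun p : KGraph.pathsLE v d => G p.1) ⟨l, mem_pathsLE_iff.2 hl⟩ fun p hp => (hp (Subtype.ext ?_)).elim
  exact (existsUnique_path v d).unique (mem_pathsLE_iff.1 p.2) hl

theorem prev_mk_of_eq_add_one {i j : ℕ+} (h : j = i + 1) : prev (⟨j⟩ : LambdaN n) = ⟨i⟩ := by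
  subst h
  have h1 : i + 1 ≠ 1 := (PNat.lt_add_left 1 i).ne'
  simp [prev, h1, PNat.add_sub]

theorem iterate_prev {i : ℕ+} {m : ℕ} {j : ℕ+} (h : (j : ℕ) = i + m) :
    prev^[m] (⟨j⟩ : LambdaN n) = ⟨i⟩ := by
  induction m generalizing j with
  | zero => rw [PNat.eq (h.trans (add_zero _))]; rfl
  | succ m ih =>
    have hj : j = ⟨i + m, by positivity⟩ + 1 := PNat.eq (by rw [h]; rfl)
    rw [Function.iterate_succ_apply, prev_mk_of_eq_add_one hj]
    exact ih rfl

theorem prev_one : prev (⟨1⟩ : LambdaN n) = ⟨n⟩ := by simp [prev]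

theorem iterate_prev_sub_one (j : ℕ+) : prev^[(j : ℕ) - 1] (⟨j⟩ : LambdaN n) = ⟨1⟩ :=
  iterate_prev (by have := j.pos; rw [PNat.one_coe]; omega)

theorem iterate_prev_self : prev^[(n : ℕ)] (⟨n⟩ : LambdaN n) = ⟨n⟩ := by
  obtain ⟨m, hm⟩ : ∃ m, (n : ℕ) = m + 1 := ⟨(n : ℕ) - 1, by have := n.pos; omega⟩
  have h1 := iterate_prev_sub_one (n := n) n
  rw [hm, Nat.add_sub_cancel] at h1
  rw [hm, Function.iterate_succ_apply', h1, prev_one]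

/-- A step back lowers the index by one, except at `v_1`, where it adds `n - 1`. So the index plus
the number of steps is constant modulo `n`. -/
theorem dvd_iterate_prev (v : LambdaN n) (m : ℕ) :
    (n : ℤ) ∣ ((prev^[m] v).idx : ℤ) - (v.idx : ℤ) + m := by
  induction m with
  | zero => simp
  | succ m ih =>
    rw [Function.iterate_succ_apply']
    generalize prev^[m] v = w at ih
    by_cases hw : w.idx = 1
    · have h1 : (prev w).idx = n := by simp [prev, hw]
      rw [h1]
      rw [hw] at ih
      obtain ⟨k, hk⟩ := ih
      refine ⟨k + 1, ?_⟩
      rw [mul_add, ← hk]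
      push_cast
      ring
    · obtain ⟨i, hi⟩ : ∃ i, w.idx = i + 1 := ⟨w.idx - 1, by
        rw [PNat.sub_add_of_lt (lt_of_le_of_ne one_le (Ne.symm hw))]⟩
      have h1 : prev w = ⟨i⟩ := prev_mk_of_eq_add_one hi
      rw [h1]
      rw [hi] at ih
      convert ih using 1
      push_cast
      ring

end LambdaN

/-! ### Cuntz–Krieger families of `Λ_n` -/

namespace CKFamily

variable {n : ℕ+} {A B : Type*} [NonUnitalCStarAlgebra A] [NonUnitalCStarAlgebra B]

open LambdaN

/-- A Cuntz–Krieger family of `Λ_n` is a representation of the path category by partial isometries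
whose final projections are those of the vertices. -/
def ofUnitaries (S : ∀ {a b : LambdaN n}, (a ⟶ b) → A)
    (orth : ∀ v w : LambdaN n, v ≠ w → S (𝟙 v) * S (𝟙 w) = 0)
    (comp : ∀ {a b c : LambdaN n} (ν : a ⟶ b) (μ : b ⟶ c), S μ * S ν = S (ν ≫ μ))
    (initial : ∀ {a b : LambdaN n} (l : a ⟶ b), star (S l) * S l = S (𝟙 a))
    (final : ∀ {a b : LambdaN n} (l : a ⟶ b), S l * star (S l) = S (𝟙 b)) :
    CKFamily (LambdaN n) A where
  S := S
  partialIsometry l := by rw [final, comp, Category.comp_id]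
  ck1_proj v :=
    { isIdempotentElem := by rw [IsIdempotentElem, comp, Category.comp_id]
      isSelfAdjoint := by rw [IsSelfAdjoint, ← initial (𝟙 v), star_mul, star_star] }
  ck1_orth := orth
  ck2 := comp
  ck3 := initial
  ck4 v d := by
    rw [finsum_pathsLE d (fun p => S p.2 * star (S p.2))
      (l := ⟨_, (LambdaN.Path.mk d rfl : LambdaN.Path _ v)⟩) rfl, final]

variable (S : CKFamily (LambdaN n) A)

/-- The generator of the path with range `v` and degree `(a, b)`. -/
def el (v : LambdaN n) (a b : ℕ) : A :=
  S.S (show prev^[a + b] v ⟶ v from LambdaN.Path.mk ![a, b] rfl)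

theorem S_eq_el {v w : LambdaN n} (l : w ⟶ v) : S.S l = S.el v (KGraph.deg l 0) (KGraph.deg l 1) := by
  obtain ⟨d, rfl⟩ := l
  have hd : ![d 0, d 1] = d := by ext i; fin_cases i <;> rfl
  change S.S _ = S.S _
  congr 1
  exact LambdaN.Path.ext hd.symm

theorem el_zero (v : LambdaN n) : S.el v 0 0 = S.S (𝟙 v) := by
  rw [S_eq_el, KGraph.deg_id]; rfl

theorem el_mul {v w : LambdaN n} {a b : ℕ} (hw : prev^[a + b] v = w) (c d : ℕ) :
    S.el v a b * S.el w c d = S.el v (a + c) (b + d) := by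
  subst hw
  rw [el, el, S.ck2, S_eq_el, KGraph.deg_comp]
  rfl

theorem star_el_mul_el {v w : LambdaN n} {a b : ℕ} (hw : prev^[a + b] v = w) :
    star (S.el v a b) * S.el v a b = S.el w 0 0 := by
  subst hw
  rw [el, S.ck3, el_zero]

/-- The Cuntz–Krieger sum for the degree `(a, b)` has a single term. -/
theorem el_mul_star_el (v : LambdaN n) (a b : ℕ) :
    S.el v a b * star (S.el v a b) = S.el v 0 0 := by
  rw [el_zero, S.ck4 v ![a, b], finsum_pathsLE ![a, b] (fun p => S.S p.2 * star (S.S p.2))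
    (l := ⟨_, (LambdaN.Path.mk ![a, b] rfl : LambdaN.Path (prev^[a + b] v) v)⟩) rfl]
  rfl

theorem S_mul_star_S {v w : LambdaN n} (l : w ⟶ v) : S.S l * star (S.S l) = S.S (𝟙 v) := by
  rw [S_eq_el, el_mul_star_el, el_zero]

/-- The image of a Cuntz–Krieger family under a homomorphism. -/
def map (φ : A →⋆ₙₐ[ℂ] B) : CKFamily (LambdaN n) B :=
  ofUnitaries (fun l => φ (S.S l)) (fun v w h => by rw [← map_mul, S.ck1_orth v w h, map_zero])
    (fun ν μ => by rw [← map_mul, S.ck2]) (fun l => by rw [← map_star, ← map_mul, S.ck3])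
    (fun l => by rw [← map_star, ← map_mul, S_mul_star_S])

theorem S_e (i : ℕ+) : S.S (e n i) = S.el ⟨i⟩ 1 0 := by rw [S_eq_el]; rfl

theorem S_f (i : ℕ+) : S.S (f n i) = S.el ⟨i⟩ 0 1 := by rw [S_eq_el]; rfl

theorem tail_eq_el {i : ℕ+} {m : ℕ} {j : ℕ+} (h : (j : ℕ) = i + m) :
    S.tail i m = S.el ⟨j⟩ m 0 := by
  induction m generalizing j with
  | zero => rw [PNat.eq (h.trans (add_zero _)), el_zero, tail]
  | succ m ih =>
    have hj : i + m.succPNat = j := PNat.eq (by rw [h]; rfl)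
    have hj' : j = ⟨i + m, by positivity⟩ + 1 := PNat.eq (by rw [h]; rfl)
    rw [tail, hj, ih (j := ⟨i + m, by positivity⟩) rfl, S_e,
      S.el_mul (by exact prev_mk_of_eq_add_one hj'),
      add_comm]

theorem theta_of_le {i j : ℕ+} (h : i ≤ j) : S.theta i j = S.el ⟨j⟩ ((j : ℕ) - i) 0 := by
  have : (i : ℕ) ≤ j := h
  rw [theta, if_pos h, S.tail_eq_el]
  omega

theorem el_mul_el_zero {v w : LambdaN n} {a b : ℕ} (hw : prev^[a + b] v = w) :
    S.el v a b * S.el w 0 0 = S.el v a b := S.el_mul hw 0 0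

theorem el_zero_mul_el (v : LambdaN n) (a b : ℕ) : S.el v 0 0 * S.el v a b = S.el v a b := by
  rw [S.el_mul (v := v) (w := v) rfl, zero_add, zero_add]

theorem star_el_zero (v : LambdaN n) : star (S.el v 0 0) = S.el v 0 0 := by
  rw [el_zero]; exact (S.ck1_proj v).isSelfAdjoint

theorem theta_eq_of_le {i j : ℕ+} (h : i ≤ j) :
    S.theta i j = S.el ⟨j⟩ ((j : ℕ) - 1) 0 * star (S.el ⟨i⟩ ((i : ℕ) - 1) 0) := by
  have hij : (i : ℕ) ≤ j := h
  have hp : prev^[(j : ℕ) - i + 0] (⟨j⟩ : LambdaN n) = ⟨i⟩ := iterate_prev (by omega)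
  have h1 : S.el ⟨j⟩ ((j : ℕ) - 1) 0 = S.el ⟨j⟩ ((j : ℕ) - i) 0 * S.el ⟨i⟩ ((i : ℕ) - 1) 0 := by
    rw [S.el_mul hp]
    congr 1
    have := i.pos
    omega
  rw [h1, mul_assoc, el_mul_star_el, S.el_mul_el_zero hp, S.theta_of_le h]

/-- With `t_j` the solid path of length `j - 1` from `v_1` to `v_j`, both cases of the definition
become `t_j t_i^*`. The matrix unit relations then reduce to `t_j^* t_k` being `p_{v_1}` or `0`. -/
theorem theta_eq (i j : ℕ+) :
    S.theta i j = S.el ⟨j⟩ ((j : ℕ) - 1) 0 * star (S.el ⟨i⟩ ((i : ℕ) - 1) 0) := by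
  by_cases h : i ≤ j
  · exact S.theta_eq_of_le h
  · have h' : j ≤ i := le_of_not_ge h
    have h1 := S.theta_eq_of_le h'
    rw [theta, if_pos h'] at h1
    rw [theta, if_neg h, h1, star_mul, star_star]

theorem isMatrixUnits_theta : IsMatrixUnits (fun j i : ℕ+ => S.theta i j) where
  mul_eq i j k l := by
    have h1 : ∀ j : ℕ+, prev^[(j : ℕ) - 1 + 0] (⟨j⟩ : LambdaN n) = ⟨1⟩ := iterate_prev_sub_one
    have h2 : star (S.el ⟨j⟩ ((j : ℕ) - 1) 0) * S.el ⟨k⟩ ((k : ℕ) - 1) 0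
        = if j = k then S.el ⟨1⟩ 0 0 else 0 := by
      split_ifs with h
      · subst h
        exact S.star_el_mul_el (h1 j)
      · have h3 : S.el ⟨j⟩ 0 0 * S.el ⟨k⟩ 0 0 = 0 := by
          rw [el_zero, el_zero]
          exact S.ck1_orth _ _ fun h' => h (congrArg LambdaN.idx h')
        rw [← S.el_zero_mul_el ⟨j⟩, ← S.el_zero_mul_el ⟨k⟩, star_mul, star_el_zero, mul_assoc,
          ← mul_assoc (S.el ⟨j⟩ 0 0), h3, zero_mul, mul_zero]
    simp only [theta_eq]
    rw [mul_assoc, ← mul_assoc (star _), h2]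
    split_ifs with h
    · rw [← mul_assoc, S.el_mul_el_zero (h1 i)]
    · rw [zero_mul, mul_zero]
  star_eq i j := by rw [theta_eq, theta_eq, star_mul, star_star]

theorem theta_self (i : ℕ+) : S.theta i i = S.el ⟨i⟩ 0 0 := by
  rw [S.theta_of_le le_rfl, Nat.sub_self]

theorem theta_one_mul_el (a b : ℕ) : S.theta 1 n * S.el ⟨1⟩ a b = S.el ⟨n⟩ (n - 1 + a) b := by
  rw [S.theta_of_le one_le, PNat.one_coe, S.el_mul, zero_add]
  exact iterate_prev_sub_one n

theorem u₁_eq_el : S.u₁ = S.el ⟨n⟩ n 0 := by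
  rw [u₁, S_e, theta_one_mul_el, Nat.sub_add_cancel n.pos]

theorem u₂_eq_el : S.u₂ = S.el ⟨n⟩ (n - 1) 1 := by
  rw [u₂, S_f, theta_one_mul_el, add_zero]

theorem prev_u₂ : prev^[(n : ℕ) - 1 + 1] (⟨n⟩ : LambdaN n) = ⟨n⟩ := by
  rw [Nat.sub_add_cancel n.pos, iterate_prev_self]

theorem u₁_mul_u₂ : S.u₁ * S.u₂ = S.u₂ * S.u₁ := by
  rw [u₁_eq_el, u₂_eq_el, S.el_mul (by exact iterate_prev_self), S.el_mul prev_u₂, zero_add,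
    add_comm]

theorem star_u₁_mul_u₁ : star S.u₁ * S.u₁ = S.theta n n := by
  rw [u₁_eq_el, S.star_el_mul_el (by exact iterate_prev_self), theta_self]

theorem star_u₂_mul_u₂ : star S.u₂ * S.u₂ = S.theta n n := by
  rw [u₂_eq_el, S.star_el_mul_el prev_u₂, theta_self]

theorem u₁_mul_star_u₁ : S.u₁ * star S.u₁ = S.theta n n := by
  rw [u₁_eq_el, el_mul_star_el, theta_self]

theorem u₂_mul_star_u₂ : S.u₂ * star S.u₂ = S.theta n n := by
  rw [u₂_eq_el, el_mul_star_el, theta_self]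

theorem el_e_succ (i : ℕ+) : S.el ⟨i + 1⟩ 1 0 = S.theta i (i + 1) := by
  rw [S.theta_of_le (PNat.lt_add_right i 1).le, PNat.add_coe, Nat.add_sub_cancel_left, PNat.one_coe]

theorem theta_mul_of_one (a b : ℕ) :
    S.theta n 1 * (S.theta 1 n * S.el ⟨1⟩ a b) = S.el ⟨1⟩ a b := by
  have h : S.theta n 1 * S.theta 1 n = S.theta 1 1 := S.isMatrixUnits_theta.mul_same 1 n 1
  rw [← mul_assoc, h, theta_self, el_zero_mul_el]

theorem el_e_one : S.el ⟨1⟩ 1 0 = S.theta n 1 * S.u₁ := by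
  rw [u₁, S_e, theta_mul_of_one]

theorem el_f_one : S.el ⟨1⟩ 0 1 = S.theta n 1 * S.u₂ := by
  rw [u₂, S_f, theta_mul_of_one]

/-- The factorisation rule gives `f_{i+1} e_i = e_{i+1} f_i`, and multiplying by `s_{e_i}^*` from
the right solves for `f_{i+1}`. By induction the solid edges and `f_1` determine all dashed edges.
-/
theorem el_f_succ (i : ℕ+) :
    S.el ⟨i + 1⟩ 0 1 = S.el ⟨i + 1⟩ 1 0 * S.el ⟨i⟩ 0 1 * star (S.el ⟨i⟩ 1 0) := by
  have hp : prev (⟨i + 1⟩ : LambdaN n) = ⟨i⟩ := prev_mk_of_eq_add_one rfl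
  rw [S.el_mul (v := ⟨i + 1⟩) (w := ⟨i⟩) (by exact hp), zero_add, add_zero]
  have h1 : S.el ⟨i + 1⟩ 1 1 = S.el ⟨i + 1⟩ 0 1 * S.el ⟨i⟩ 1 0 := by
    rw [S.el_mul (by exact hp)]
  rw [h1, mul_assoc, el_mul_star_el, S.el_mul_el_zero (by exact hp)]

/-- A Cuntz–Krieger family of `Λ_n` is determined by the `θ_{i,j}`, `u_1` and `u_2`. -/
theorem S_eq_of_theta_eq {S T : CKFamily (LambdaN n) A} (hθ : ∀ i j, S.theta i j = T.theta i j)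
    (h₁ : S.u₁ = T.u₁) (h₂ : S.u₂ = T.u₂) {v w : LambdaN n} (l : w ⟶ v) : S.S l = T.S l := by
  have he : ∀ i : ℕ+, S.el ⟨i⟩ 1 0 = T.el ⟨i⟩ 1 0 := fun i => by
    induction i using PNat.recOn with
    | one => rw [el_e_one, el_e_one, hθ, h₁]
    | succ i _ => rw [el_e_succ, el_e_succ, hθ]
  have hf : ∀ i : ℕ+, S.el ⟨i⟩ 0 1 = T.el ⟨i⟩ 0 1 := fun i => by
    induction i using PNat.recOn with
    | one => rw [el_f_one, el_f_one, hθ, h₂]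
    | succ i ih => rw [el_f_succ, el_f_succ, ih, he, he]
  have hel : ∀ a b : ℕ, ∀ i : ℕ+, S.el ⟨i⟩ a b = T.el ⟨i⟩ a b := fun a => by
    induction a with
    | zero =>
      intro b
      induction b with
      | zero => intro i; rw [← theta_self, ← theta_self, hθ]
      | succ b ih =>
        intro i
        have h := fun U : CKFamily (LambdaN n) A =>
          U.el_mul (v := ⟨i⟩) (a := 0) (b := 1) (w := prev ⟨i⟩) rfl 0 b
        rw [add_comm b 1, ← zero_add 0, ← h, ← h, hf, ih]
    | succ a ih =>
      intro b i
      have h := fun U : CKFamily (LambdaN n) A =>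
        U.el_mul (v := ⟨i⟩) (a := 1) (b := 0) (w := prev ⟨i⟩) rfl a b
      rw [add_comm a 1, ← zero_add b, ← h, ← h, he, ih]
  rw [S_eq_el, S_eq_el]
  exact hel _ _ _

theorem map_el (φ : A →⋆ₙₐ[ℂ] B) (v : LambdaN n) (a b : ℕ) : (S.map φ).el v a b = φ (S.el v a b) :=
  rfl

theorem map_theta (φ : A →⋆ₙₐ[ℂ] B) (i j : ℕ+) : (S.map φ).theta i j = φ (S.theta i j) := by
  simp only [theta_eq, map_el, map_mul, map_star]

theorem map_u₁ (φ : A →⋆ₙₐ[ℂ] B) : (S.map φ).u₁ = φ S.u₁ := by simp only [u₁_eq_el, map_el]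

theorem map_u₂ (φ : A →⋆ₙₐ[ℂ] B) : (S.map φ).u₂ = φ S.u₂ := by simp only [u₂_eq_el, map_el]

end CKFamily

/-! ### The model of `C*(Λ_n)` on the torus -/

section model

variable {X K : Type*} [TopologicalSpace X] [CompactSpace X] [NonUnitalCStarAlgebra K]
  (R : RankOneUnits K) (h : X ≃ₜ Circle × Circle) {n : ℕ+}

open LambdaN

namespace LambdaN

/-- The number of times that a path of length `m` from `v` to `w` runs through an edge with
range `v_1`. -/
def winding (v w : LambdaN n) (m : ℕ) : ℤ := ((v.idx : ℤ) - w.idx + m) / n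

theorem dvd_of_path {v w : LambdaN n} (l : v ⟶ w) :
    (n : ℤ) ∣ (v.idx : ℤ) - w.idx + (KGraph.deg l 0 + KGraph.deg l 1 : ℕ) := by
  obtain ⟨d, rfl⟩ := l
  exact dvd_iterate_prev w _

/-- The numerators add up, and by `dvd_of_path` the division is exact. -/
theorem winding_comp {u v w : LambdaN n} (ν : u ⟶ v) (μ : v ⟶ w) :
    winding u w (KGraph.deg (ν ≫ μ) 0 + KGraph.deg (ν ≫ μ) 1)
      = winding v w (KGraph.deg μ 0 + KGraph.deg μ 1)
        + winding u v (KGraph.deg ν 0 + KGraph.deg ν 1) := by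
  rw [winding, winding, winding, ← Int.add_ediv_of_dvd_left (dvd_of_path μ), KGraph.deg_comp]
  congr 1
  simp only [Pi.add_apply]
  push_cast
  ring

theorem winding_self (v : LambdaN n) (m : ℕ) : winding v v m = m / n := by
  simp [winding]

theorem winding_eq_zero {v w : LambdaN n} {m : ℕ} (hm : (w.idx : ℕ) = v.idx + m) :
    winding v w m = 0 := by
  have : ((w.idx : ℕ) : ℤ) = v.idx + m := by exact_mod_cast hm
  rw [winding, this]
  simp

end LambdaN

/-- The Cuntz–Krieger family of `Λ_n` in `C(X, K)`, where `X` is a torus. -/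
noncomputable def model (n : ℕ+) : CKFamily (LambdaN n) C(X, K) :=
  CKFamily.ofUnitaries
    -- Both exponents are additive along paths. The subtraction normalises `u_2`, which winds once
    -- and contains one dashed edge, to the second coordinate; `u_1` becomes the first.
    (fun {v w} l => R.mat v.idx w.idx
      (mono h (winding v w (KGraph.deg l 0 + KGraph.deg l 1) - KGraph.deg l 1) (KGraph.deg l 1)))
    (fun v w hvw => R.mat_mul_ne (fun h' => hvw (LambdaN.ext h')) _ _)
    (fun ν μ => by
      rw [R.mat_mul_same, mono_mul, winding_comp, KGraph.deg_comp]
      simp only [Pi.add_apply]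
      push_cast
      congr 2
      ring)
    (fun {v w} l => by
      rw [R.star_mat, R.mat_mul_same, star_mono, mono_mul, KGraph.deg_id, winding_self]
      simp)
    (fun {v w} l => by
      rw [R.star_mat, R.mat_mul_same, star_mono, mono_mul, KGraph.deg_id, winding_self]
      simp)

theorem model_el {v w : LambdaN n} {a b : ℕ} (hw : prev^[a + b] v = w) :
    (model R h n).el v a b = R.mat w.idx v.idx (mono h (winding w v (a + b) - b) b) := by
  subst hw
  rfl

theorem model_theta (i j : ℕ+) : (model R h n).theta i j = R.mat i j 1 := by
  have key : ∀ i j : ℕ+, i ≤ j → (model R h n).theta i j = R.mat i j 1 := fun i j hij => by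
    have hij' : (i : ℕ) ≤ j := hij
    rw [CKFamily.theta_of_le _ hij, model_el R h (w := ⟨i⟩) (iterate_prev (by omega)),
      winding_eq_zero (by simp only; omega), ← mono_zero h]
    simp
  by_cases hij : i ≤ j
  · exact key i j hij
  · rw [← (model R h n).isMatrixUnits_theta.star_eq i j, key j i (le_of_not_ge hij), R.star_mat,
      star_one]

theorem model_u₁ : (model R h n).u₁ = R.mat n n (mono h 1 0) := by
  rw [CKFamily.u₁_eq_el, model_el R h (w := ⟨n⟩) (by exact iterate_prev_self), winding_self]
  simp

theorem model_u₂ : (model R h n).u₂ = R.mat n n (mono h 0 1) := by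
  rw [CKFamily.u₂_eq_el, model_el R h CKFamily.prev_u₂, winding_self, Nat.sub_add_cancel n.pos]
  simp

/-- A closed star-subalgebra of `C(X, K)` that contains the model family is everything. -/
theorem mem_of_model_mem {N : NonUnitalStarSubalgebra ℂ C(X, K)} (hN : IsClosed (N : Set C(X, K)))
    (hmem : ∀ {v w : LambdaN n} (l : v ⟶ w), (model R h n).S l ∈ N) (f : C(X, K)) : f ∈ N := by
  have hθ : ∀ i j, R.mat i j 1 ∈ N := fun i j => by
    rw [← model_theta R h (n := n), CKFamily.theta_eq]
    exact mul_mem (hmem _) (star_mem (hmem _))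
  have h₁ : R.mat n n (mono h 1 0) ∈ N := by
    rw [← model_u₁ R h, CKFamily.u₁_eq_el]
    exact hmem _
  have h₂ : R.mat n n (mono h 0 1) ∈ N := by
    rw [← model_u₂ R h, CKFamily.u₂_eq_el]
    exact hmem _
  have hM : ∀ g, R.mat n n g ∈ N :=
    mem_of_coord_mem h (N := N.comap (R.matHom n)) (hN.preimage (R.mat n n).continuous) (hθ n n) h₁ h₂
  refine R.mem_of_forall_mat_mem (W := N.toSubmodule) hN fun i j => ?_
  change R.mat i j _ ∈ N
  have h3 := mul_mem (mul_mem (hθ n j) (hM (R.fnEntry i j f))) (hθ i n)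
  rwa [R.mat_mul_same, R.mat_mul_same, one_mul, mul_one] at h3

/-- The calculus of `u_1`, `u_2` in the corner of `p_{v_n}`, spread over all corners by the matrix
units, gives `Ψ`. The image of the model under `Ψ` has the same `θ_{i,j}`, `u_1` and `u_2` as `S`,
and these determine a family. -/
theorem exists_hom_of_model {A : Type*} [NonUnitalCStarAlgebra A] (S : CKFamily (LambdaN n) A) :
    ∃ Ψ : C(X, K) →⋆ₙₐ[ℂ] A, ∀ {v w : LambdaN n} (l : v ⟶ w), Ψ ((model R h n).S l) = S.S l := by
  have hp : IsStarProjection (S.theta n n) := by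
    rw [CKFamily.theta_self, CKFamily.el_zero]
    exact S.ck1_proj _
  obtain ⟨φ, h1, hw, hz⟩ := exists_corner_calculus h hp S.star_u₁_mul_u₁ S.u₁_mul_star_u₁
    S.star_u₂_mul_u₂ S.u₂_mul_star_u₂ S.u₁_mul_u₂
  obtain ⟨Ψ, hΨ⟩ := S.isMatrixUnits_theta.exists_hom R h1
  have hθ : ∀ i j, Ψ (R.mat i j 1) = S.theta i j := fun i j => by
    rw [hΨ, h1, S.isMatrixUnits_theta.mul_same j n n, S.isMatrixUnits_theta.mul_same j n i]
  have hcorner : ∀ g, Ψ (R.mat n n g) = φ g := fun g => by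
    rw [hΨ, ← h1, ← map_mul, ← map_mul, one_mul, mul_one]
  refine ⟨Ψ, fun l => ?_⟩
  refine CKFamily.S_eq_of_theta_eq (S := (model R h n).map Ψ) ?_ ?_ ?_ l
  · intro i j
    rw [CKFamily.map_theta, model_theta, hθ]
  · rw [CKFamily.map_u₁, model_u₁, hcorner, hw]
  · rw [CKFamily.map_u₂, model_u₂, hcorner, hz]

/-- Universality tests algebras in the universe of `C(X, K)`, whence a copy `X` of the torus in
`Type u`. -/
theorem isUniversal_model {X : Type u} {K : Type} [TopologicalSpace X] [CompactSpace X]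
    [NonUnitalCStarAlgebra K] (R : RankOneUnits K) (h : X ≃ₜ Circle × Circle) :
    (model R h n).IsUniversal where
  generates := by
    rw [eq_top_iff]
    intro f _
    refine mem_of_model_mem R h (n := n) (NonUnitalStarSubalgebra.isClosed_topologicalClosure _) ?_ f
    intro v w l
    exact NonUnitalStarSubalgebra.le_topologicalClosure _
      (NonUnitalStarAlgebra.subset_adjoin ℂ _ ⟨v, w, l, rfl⟩)
  exists_hom _ _ T := exists_hom_of_model R h T

/-- Homomorphisms out of the C*-algebra generated by a Cuntz–Krieger family are determined by
their values on the generators. -/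
theorem CKFamily.IsUniversal.hom_ext {A : Type u} {B : Type*} [NonUnitalCStarAlgebra A]
    [NonUnitalCStarAlgebra B] {k : ℕ} {V : Type} [SmallCategory V] [KGraph k V]
    {S : CKFamily V A} (hS : S.IsUniversal)
    {φ ψ : A →⋆ₙₐ[ℂ] B} (hφ : ∀ {a b : V} (l : a ⟶ b), φ (S.S l) = ψ (S.S l)) : φ = ψ := by
  have h1 : NonUnitalStarAlgebra.adjoin ℂ {x : A | ∃ (a b : V) (l : a ⟶ b), x = S.S l}
      ≤ NonUnitalStarAlgHom.equalizer φ ψ :=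
    NonUnitalStarAlgebra.adjoin_le (by rintro _ ⟨a, b, l, rfl⟩; exact hφ l)
  have h2 := NonUnitalStarSubalgebra.topologicalClosure_minimal _ h1
    (isClosed_eq (continuous_starHom φ) (continuous_starHom ψ))
  rw [hS.generates] at h2
  exact NonUnitalStarAlgHom.ext fun x => h2 (NonUnitalStarAlgebra.mem_top (R := ℂ))

/-- Every realisation of `C*(Λ_n)` is isomorphic to the model. -/
theorem CKFamily.IsUniversal.exists_equiv {X A : Type u} {K : Type} [TopologicalSpace X]
    [CompactSpace X] [NonUnitalCStarAlgebra K] (R : RankOneUnits K) (h : X ≃ₜ Circle × Circle)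
    [NonUnitalCStarAlgebra A] {S : CKFamily (LambdaN n) A} (hS : S.IsUniversal) :
    ∃ Φ : A ≃⋆ₐ[ℂ] C(X, K), ∀ {v w : LambdaN n} (l : v ⟶ w), Φ (S.S l) = (model R h n).S l := by
  obtain ⟨π, hπ⟩ := hS.exists_hom _ (model R h n)
  obtain ⟨Ψ, hΨ⟩ := exists_hom_of_model R h S
  have h1 : Ψ.comp π = NonUnitalStarAlgHom.id ℂ A := hS.hom_ext fun l => by
    change Ψ (π _) = S.S l
    rw [hπ, hΨ]
  have h2 : π.comp Ψ = NonUnitalStarAlgHom.id ℂ C(X, K) := (isUniversal_model R h).hom_ext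
    fun l => by
      change π (Ψ _) = (model R h n).S l
      rw [hΨ, hπ]
  have hb : Function.Bijective π := Function.bijective_iff_has_inverse.2
    ⟨Ψ, fun x => DFunLike.congr_fun h1 x, fun x => DFunLike.congr_fun h2 x⟩
  exact ⟨StarAlgEquiv.ofBijective π hb, fun l => hπ l⟩

end model

/-! ### Multipliers -/

section multipliers

variable {X K A : Type*} [TopologicalSpace X] [CompactSpace X] [NonUnitalCStarAlgebra K]
  [NonUnitalCStarAlgebra A]

/-- Pointwise multiplication of a `K`-valued function by a scalar function. -/
noncomputable def smulFn (g : C(X, ℂ)) : C(X, K) →ₗ[ℂ] C(X, K) where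
  toFun f := ⟨fun x => g x • f x, g.continuous.smul f.continuous⟩
  map_add' f f' := by ext1 x; simp
  map_smul' c f := by ext1 x; simp [smul_comm c]

omit [CompactSpace X] in
@[simp] theorem smulFn_apply (g : C(X, ℂ)) (f : C(X, K)) (x : X) : smulFn g f x = g x • f x := rfl

theorem continuous_smulFn (g : C(X, ℂ)) : Continuous (smulFn (K := K) g) :=
  AddMonoidHomClass.continuous_of_bound (smulFn g) ‖g‖ fun f =>
    (ContinuousMap.norm_le _ (by positivity)).2 fun x => by
      rw [smulFn_apply, norm_smul]
      exact mul_le_mul (g.norm_coe_le_norm x) (f.norm_coe_le_norm x) (norm_nonneg _) (norm_nonneg _)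

omit [CompactSpace X] in
theorem smulFn_mat (R : RankOneUnits K) (g g' : C(X, ℂ)) (i j : ℕ+) :
    smulFn g (R.mat i j g') = R.mat i j (g * g') := by
  ext1 x
  simp [smul_smul]

variable (Φ : A ≃⋆ₐ[ℂ] C(X, K))

theorem continuous_starEquiv {A B : Type*} [NonUnitalCStarAlgebra A] [NonUnitalCStarAlgebra B]
    (Φ : A ≃⋆ₐ[ℂ] B) : Continuous Φ :=
  continuous_starHom (Φ : A →⋆ₙₐ[ℂ] B)

/-- Multiplication by a scalar function, transported to `A`. -/
noncomputable def multCLM (g : C(X, ℂ)) : A →L[ℂ] A where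
  toFun a := Φ.symm (smulFn g (Φ a))
  map_add' a b := by rw [map_add, map_add, map_add]
  map_smul' c a := by rw [map_smul, map_smul, map_smul]; rfl
  cont := (continuous_starEquiv Φ.symm).comp ((continuous_smulFn g).comp (continuous_starEquiv Φ))

theorem apply_multCLM (g : C(X, ℂ)) (a : A) : Φ (multCLM Φ g a) = smulFn g (Φ a) :=
  Φ.apply_symm_apply _

/-- The multiplier of `A` given by a scalar function. -/
noncomputable def multiplier (g : C(X, ℂ)) : 𝓜(ℂ, A) where
  fst := multCLM Φ g
  snd := multCLM Φ g
  central a b := EquivLike.injective Φ <| by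
    rw [map_mul, map_mul, apply_multCLM, apply_multCLM]
    ext1 x
    simp [smul_mul_assoc, mul_smul_comm]

theorem multiplier_ext {M M' : 𝓜(ℂ, A)} (h₁ : ∀ a, M.fst a = M'.fst a)
    (h₂ : ∀ a, M.snd a = M'.snd a) : M = M' :=
  DoubleCentralizer.ext ℂ A M M' (Prod.ext (ContinuousLinearMap.ext h₁) (ContinuousLinearMap.ext h₂))

theorem multCLM_one (a : A) : multCLM Φ 1 a = a := EquivLike.injective Φ <| by
  rw [apply_multCLM]
  ext1 x
  simp

theorem multCLM_mul (g g' : C(X, ℂ)) (a : A) :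
    multCLM Φ (g * g') a = multCLM Φ g (multCLM Φ g' a) := EquivLike.injective Φ <| by
  rw [apply_multCLM, apply_multCLM, apply_multCLM]
  ext1 x
  simp [smul_smul]

theorem multCLM_star (g : C(X, ℂ)) (a : A) :
    multCLM Φ (star g) a = star (multCLM Φ g (star a)) := EquivLike.injective Φ <| by
  rw [apply_multCLM, map_star, apply_multCLM, map_star]
  ext1 x
  simp

/-- The scalar functions as multipliers. -/
noncomputable def multiplierHom : C(X, ℂ) →⋆* 𝓜(ℂ, A) where
  toFun := multiplier Φ
  map_one' := multiplier_ext (multCLM_one Φ) (multCLM_one Φ)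
  map_mul' g g' := multiplier_ext (multCLM_mul Φ g g') fun a => by
    rw [mul_comm]
    exact multCLM_mul Φ g' g a
  map_star' g := multiplier_ext (multCLM_star Φ g) (multCLM_star Φ g)

theorem multiplierHom_fst (g : C(X, ℂ)) (a : A) : (multiplierHom Φ g).fst a = multCLM Φ g a := rfl

/-- If a multiplier is invertible then the scalar function has no zero. -/
theorem mem_spectrum_multiplier (R : RankOneUnits K) (g : C(X, ℂ)) (x : X) :
    g x ∈ spectrum ℂ (multiplierHom Φ g) := by
  rw [spectrum.mem_iff]
  rintro ⟨M, hM⟩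
  have h1 : (M : 𝓜(ℂ, A)) * (M⁻¹ : (𝓜(ℂ, A))ˣ) = 1 := M.mul_inv
  rw [hM] at h1
  -- Applied to this element and evaluated at `x`, an inverse of `g x - g` would give `0 = unit 1
  -- 1`.
  let a := Φ.symm (R.mat 1 1 1)
  let b := (((M⁻¹ : (𝓜(ℂ, A))ˣ) : 𝓜(ℂ, A)).fst : A →L[ℂ] A) a
  have h2 : g x • b - multCLM Φ g b = a := by
    have := congrArg (fun N : 𝓜(ℂ, A) => (N.fst : A →L[ℂ] A) a) h1
    simpa [b, multiplierHom_fst] using this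
  have h3 := congrArg (fun c => Φ c x) h2
  simp only [a, map_sub, map_smul, apply_multCLM, StarAlgEquiv.apply_symm_apply,
    ContinuousMap.sub_apply, ContinuousMap.smul_apply, smulFn_apply, sub_self, R.mat_apply,
    ContinuousMap.one_apply, one_smul] at h3
  exact R.ne_zero 1 1 h3.symm

/-! ### Monomials as unitary multipliers. -/

variable (h : X ≃ₜ Circle × Circle)

/-- The monomials as elements of the unitary group. -/
noncomputable def monoUnitary (a b : ℤ) : unitary C(X, ℂ) :=
  ⟨mono h a b, by
    rw [Unitary.mem_iff, star_mono, mono_mul, mono_mul, ← mono_zero h]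
    simp⟩

omit [CompactSpace X] in
theorem monoUnitary_mul (a b c d : ℤ) :
    monoUnitary h a b * monoUnitary h c d = monoUnitary h (a + c) (b + d) :=
  Subtype.ext (mono_mul h a b c d)

omit [CompactSpace X] in
theorem monoUnitary_zero : monoUnitary h 0 0 = 1 := Subtype.ext (mono_zero h)

omit [CompactSpace X] in
theorem monoUnitary_zpow_mul (a b : ℤ) :
    monoUnitary h 1 0 ^ a * monoUnitary h 0 1 ^ b = monoUnitary h a b := by
  -- Each coordinate gives a homomorphism from the integers, which consists of the powers of its
  -- value at `1`.
  let f₁ : Multiplicative ℤ →* unitary C(X, ℂ) :=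
    { toFun := fun k => monoUnitary h k.toAdd 0
      map_one' := monoUnitary_zero h
      map_mul' := fun j k => by rw [monoUnitary_mul]; rfl }
  let f₂ : Multiplicative ℤ →* unitary C(X, ℂ) :=
    { toFun := fun k => monoUnitary h 0 k.toAdd
      map_one' := monoUnitary_zero h
      map_mul' := fun j k => by rw [monoUnitary_mul]; rfl }
  have h₁ : monoUnitary h a 0 = monoUnitary h 1 0 ^ a := f₁.apply_mint _ (Multiplicative.ofAdd a)
  have h₂ : monoUnitary h 0 b = monoUnitary h 0 1 ^ b := f₂.apply_mint _ (Multiplicative.ofAdd b)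
  rw [← h₁, ← h₂, monoUnitary_mul, zero_add, add_zero]

/-- The unitary multiplier given by a monomial. -/
noncomputable def multiplierUnitary (a b : ℤ) : unitary 𝓜(ℂ, A) :=
  Unitary.map (multiplierHom Φ) (monoUnitary h a b)

theorem multiplierUnitary_zpow_mul (a b : ℤ) :
    multiplierUnitary Φ h 1 0 ^ a * multiplierUnitary Φ h 0 1 ^ b = multiplierUnitary Φ h a b := by
  rw [multiplierUnitary, multiplierUnitary, ← map_zpow, ← map_zpow, ← map_mul, monoUnitary_zpow_mul]
  rfl

/-- The spectrum of a unitary lies in the circle, and every value of the function lies in the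
spectrum of its multiplier. -/
theorem spectrum_multiplierUnitary (R : RankOneUnits K) {a b : ℤ}
    (hs : ∀ c : Circle, ∃ x, mono h a b x = c) :
    spectrum ℂ (multiplierUnitary Φ h a b : 𝓜(ℂ, A)) = Metric.sphere 0 1 := by
  refine Set.Subset.antisymm (Unitary.spectrum_subset_circle _) fun c hc => ?_
  obtain ⟨x, hx⟩ := hs ⟨c, hc⟩
  have := mem_spectrum_multiplier Φ R (mono h a b) x
  rwa [hx] at this

/-- `Φ` carries `x j * c` to a diagonal projection times the function `mono h a b • Φ c`, so the
diagonal sums of that one function converge to the required limit; likewise on the right. -/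
theorem hasStrictSum_multiplierUnitary (R : RankOneUnits K) {a b : ℤ} {x : ℕ+ → A}
    (hx : ∀ j, Φ (x j) = R.mat j j (mono h a b)) :
    HasStrictSum x (multiplierUnitary Φ h a b : 𝓜(ℂ, A)) := by
  intro c
  have hΦ := continuous_starEquiv Φ.symm
  constructor
  · have h1 := (R.hasSum_mat_mul (smulFn (mono h a b) (Φ c))).map Φ.symm hΦ
    change HasSum _ (Φ.symm (smulFn (mono h a b) (Φ c)))
    convert h1 using 2 with j
    rw [Function.comp_apply, eq_comm, StarAlgEquiv.symm_apply_eq, map_mul, hx]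
    ext1 y
    simp [smul_mul_assoc, mul_smul_comm]
  · have h1 := (R.hasSum_mul_mat (smulFn (mono h a b) (Φ c))).map Φ.symm hΦ
    change HasSum _ (Φ.symm (smulFn (mono h a b) (Φ c)))
    convert h1 using 2 with j
    rw [Function.comp_apply, eq_comm, StarAlgEquiv.symm_apply_eq, map_mul, hx]
    ext1 y
    simp [smul_mul_assoc, mul_smul_comm]

/-- Two density arguments combine: corners for the matrix variable and monomials for the torus
variable. -/
theorem closure_span_eq_univ (R : RankOneUnits K) {s : Set A}
    (hs : ∀ i j a b, Φ.symm (R.mat i j (mono h a b)) ∈ s) :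
    closure (Submodule.span ℂ s : Set A) = Set.univ := by
  rw [Set.eq_univ_iff_forall]
  intro c
  let W := (Submodule.span ℂ s).topologicalClosure
  have hW : IsClosed (W : Set A) := Submodule.isClosed_topologicalClosure _
  let V : Submodule ℂ C(X, K) := W.comap (Φ.symm : C(X, K) →ₗ[ℂ] A)
  have hV : IsClosed (V : Set C(X, K)) := hW.preimage (continuous_starEquiv Φ.symm)
  have h1 : ∀ i j g, R.mat i j g ∈ V := fun i j =>
    mem_of_forall_mono_mem h (N := V.comap (R.mat i j).toLinearMap)
      (hV.preimage (R.mat i j).continuous) fun a b =>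
        Submodule.le_topologicalClosure _ (Submodule.subset_span (hs i j a b))
  have h2 : Φ c ∈ V := R.mem_of_forall_mat_mem hV fun i j => h1 i j _
  have h3 : Φ.symm (Φ c) ∈ W := h2
  rwa [StarAlgEquiv.symm_apply_apply] at h3

/-- Composition with a homeomorphism. -/
def compHomeomorph {Y : Type*} [TopologicalSpace Y] (e : X ≃ₜ Y) : C(X, K) ≃⋆ₐ[ℂ] C(Y, K) where
  toFun f := f.comp e.symm
  invFun f := f.comp e
  left_inv f := by ext1 x; simp
  right_inv f := by ext1 x; simp
  map_mul' _ _ := rfl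
  map_add' _ _ := rfl
  map_smul' _ _ := rfl
  map_star' _ := rfl

end multipliers

/-! ### The structure of an arbitrary realisation. -/

theorem structure_of_isUniversal {A : Type u} [NonUnitalCStarAlgebra A] {K : Type}
    [NonUnitalCStarAlgebra K] (R : RankOneUnits K) {n : ℕ+} {S : CKFamily (LambdaN n) A}
    (hS : S.IsUniversal) :
    (∀ i j : ℕ+, S.theta i j ≠ 0) ∧
      ∃ U₁ U₂ : unitary 𝓜(ℂ, A),
        HasStrictSum (fun j : ℕ+ => S.theta n j * S.u₁ * S.theta j n) (U₁ : 𝓜(ℂ, A)) ∧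
        HasStrictSum (fun j : ℕ+ => S.theta n j * S.u₂ * S.theta j n) (U₂ : 𝓜(ℂ, A)) ∧
        U₁ * U₂ = U₂ * U₁ ∧
        spectrum ℂ (U₁ : 𝓜(ℂ, A)) = Metric.sphere 0 1 ∧
        spectrum ℂ (U₂ : 𝓜(ℂ, A)) = Metric.sphere 0 1 ∧
        closure (Submodule.span ℂ {x : A | ∃ (i j : ℕ+) (a b : ℤ),
          x = ((U₁ ^ a * U₂ ^ b : unitary 𝓜(ℂ, A)) : 𝓜(ℂ, A)).snd (S.theta i j)} : Set A)
            = Set.univ ∧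
        ∃ Φ : A ≃⋆ₐ[ℂ] C(Circle × Circle, K),
          ∀ (i j : ℕ+) (a b : ℤ) (w z : Circle),
            Φ (((U₁ ^ a * U₂ ^ b : unitary 𝓜(ℂ, A)) : 𝓜(ℂ, A)).snd (S.theta i j)) (w, z) =
              ((w ^ a * z ^ b : Circle) : ℂ) • R.unit i j := by
  let h : ULift.{u} (Circle × Circle) ≃ₜ Circle × Circle := Homeomorph.ulift
  obtain ⟨Φ, hΦ⟩ := hS.exists_equiv R h
  have hθ : ∀ i j, Φ (S.theta i j) = R.mat i j 1 := fun i j => by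
    rw [← model_theta R h (n := n), CKFamily.theta_eq, CKFamily.theta_eq, map_mul, map_star,
      CKFamily.el, CKFamily.el, hΦ, hΦ]
    rfl
  have h₁ : Φ S.u₁ = R.mat n n (mono h 1 0) := by
    rw [← model_u₁ R h, CKFamily.u₁_eq_el, CKFamily.u₁_eq_el, CKFamily.el, hΦ]
    rfl
  have h₂ : Φ S.u₂ = R.mat n n (mono h 0 1) := by
    rw [← model_u₂ R h, CKFamily.u₂_eq_el, CKFamily.u₂_eq_el, CKFamily.el, hΦ]
    rfl
  have hsnd : ∀ i j a b, (multiplierUnitary Φ h a b : 𝓜(ℂ, A)).snd (S.theta i j)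
      = Φ.symm (R.mat i j (mono h a b)) := fun i j a b => by
    change Φ.symm (smulFn (mono h a b) (Φ (S.theta i j))) = _
    rw [hθ, smulFn_mat, mul_one]
  -- `compHomeomorph h` returns from the lifted torus to the torus itself.
  refine ⟨fun i j h0 => ?_, multiplierUnitary Φ h 1 0, multiplierUnitary Φ h 0 1, ?_, ?_, ?_, ?_, ?_,
    ?_, Φ.trans (compHomeomorph h), ?_⟩
  · have h3 := hθ i j
    rw [h0, map_zero] at h3
    have h4 := congrArg (fun f : C(_, K) => f (h.symm 1)) h3
    simp only [ContinuousMap.zero_apply, R.mat_apply, ContinuousMap.one_apply, one_smul] at h4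
    exact R.ne_zero i j h4.symm
  · refine hasStrictSum_multiplierUnitary Φ h R fun j => ?_
    rw [map_mul, map_mul, hθ, hθ, h₁, R.mat_mul_same, R.mat_mul_same, one_mul, mul_one]
  · refine hasStrictSum_multiplierUnitary Φ h R fun j => ?_
    rw [map_mul, map_mul, hθ, hθ, h₂, R.mat_mul_same, R.mat_mul_same, one_mul, mul_one]
  · rw [multiplierUnitary, multiplierUnitary, ← map_mul, ← map_mul, mul_comm]
  · exact spectrum_multiplierUnitary Φ h R fun c => ⟨h.symm (c, 1), by simp⟩
  · exact spectrum_multiplierUnitary Φ h R fun c => ⟨h.symm (1, c), by simp⟩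
  · refine closure_span_eq_univ Φ h R fun i j a b => ⟨i, j, a, b, ?_⟩
    rw [multiplierUnitary_zpow_mul, hsnd]
  · intro i j a b w z
    rw [multiplierUnitary_zpow_mul, hsnd]
    change Φ (Φ.symm (R.mat i j (mono h a b))) (h.symm (w, z)) = _
    rw [StarAlgEquiv.apply_symm_apply, R.mat_apply, mono_apply, Homeomorph.apply_symm_apply]

/-! ### The gauge action on the model -/

section gauge

variable {X K : Type*} [TopologicalSpace X] [CompactSpace X] [NonUnitalCStarAlgebra K]
  (R : RankOneUnits K) (h : X ≃ₜ Circle × Circle) {n : ℕ+}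

/-- The rotation of the torus that corresponds to the gauge action. -/
noncomputable def gaugeRotation (n : ℕ+) (z : Fin 2 → Circle) : C(X, X) where
  toFun x := h.symm (z 0 ^ (n : ℕ) * (h x).1, z 0 ^ ((n : ℕ) - 1) * z 1 * (h x).2)
  continuous_toFun := h.symm.continuous.comp <|
    (continuous_const.mul (continuous_fst.comp h.continuous)).prodMk
      (continuous_const.mul (continuous_snd.comp h.continuous))

omit [CompactSpace X] in
theorem gaugeRotation_apply (z : Fin 2 → Circle) (x : X) : gaugeRotation h n z x =
    h.symm (z 0 ^ (n : ℕ) * (h x).1, z 0 ^ ((n : ℕ) - 1) * z 1 * (h x).2) := rfl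

/-- `γ` acts on the model family like the gauge automorphism at `z`. -/
def IsGaugeAt (n : ℕ+) (z : Fin 2 → Circle) (γ : C(X, K) →⋆ₙₐ[ℂ] C(X, K)) : Prop :=
  ∀ {v w : LambdaN n} (l : v ⟶ w),
    γ ((model R h n).S l) = torusPow z (KGraph.deg l) • (model R h n).S l

variable {R h} {z : Fin 2 → Circle} {γ : C(X, K) →⋆ₙₐ[ℂ] C(X, K)}

namespace IsGaugeAt

theorem map_el (hγ : IsGaugeAt R h n z γ) (v : LambdaN n) (a b : ℕ) :
    γ ((model R h n).el v a b)
      = ((z 0 ^ a * z 1 ^ b : Circle) : ℂ) • (model R h n).el v a b := by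
  rw [CKFamily.el, hγ, torusPow, Fin.prod_univ_two]
  rfl

/-- As `t_j t_i^*` with solid paths of lengths `j - 1` and `i - 1`, the element `θ_{i,j}` is
homogeneous of degree `(j - i, 0)`. -/
theorem map_mat_one (hγ : IsGaugeAt R h n z γ) (i j : ℕ+) :
    γ (R.mat i j 1) = ((z 0 ^ ((j : ℤ) - i) : Circle) : ℂ) • R.mat i j 1 := by
  rw [← model_theta R h (n := n), CKFamily.theta_eq, map_mul, map_star, hγ.map_el, hγ.map_el,
    star_smul, smul_mul_smul_comm, Complex.star_def, ← Circle.coe_inv_eq_conj, ← Circle.coe_mul]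
  congr 2
  have hi : ((i : ℕ) - 1 : ℕ) = ((i : ℤ) - 1) := by have := i.pos; omega
  have hj : ((j : ℕ) - 1 : ℕ) = ((j : ℤ) - 1) := by have := j.pos; omega
  rw [pow_zero, mul_one, mul_one, ← zpow_natCast, ← zpow_natCast, hi, hj, ← zpow_neg, ← zpow_add]
  congr 1
  ring

/-- Both sides are homomorphisms in `g`, so `1` and the coordinates suffice. These correspond to
`u_1` and `u_2`, whose degrees `(n, 0)` and `(n - 1, 1)` are the exponents in `gaugeRotation`. -/
theorem map_mat_self (hγ : IsGaugeAt R h n z γ) (g : C(X, ℂ)) :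
    γ (R.mat n n g) = R.mat n n (g.comp (gaugeRotation h n z)) := by
  let ρ : C(X, ℂ) →⋆ₙₐ[ℂ] C(X, ℂ) :=
    ((gaugeRotation h n z).compStarAlgHom' ℂ ℂ : C(X, ℂ) →⋆ₙₐ[ℂ] C(X, ℂ))
  have key : g ∈ NonUnitalStarAlgHom.equalizer (γ.comp (R.matHom n)) ((R.matHom n).comp ρ) := by
    refine mem_of_coord_mem h (isClosed_eq (continuous_starHom _) (continuous_starHom _)) ?_ ?_ ?_ g
    · change γ (R.mat n n 1) = R.mat n n (ρ 1)
      rw [hγ.map_mat_one, sub_self, zpow_zero, Circle.coe_one, one_smul]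
      rfl
    · change γ (R.mat n n (mono h 1 0)) = R.mat n n ((mono h 1 0).comp (gaugeRotation h n z))
      rw [← model_u₁, CKFamily.u₁_eq_el, hγ.map_el, ← CKFamily.u₁_eq_el, model_u₁, ← map_smul]
      congr 1
      ext x
      simp [gaugeRotation_apply]
    · change γ (R.mat n n (mono h 0 1)) = R.mat n n ((mono h 0 1).comp (gaugeRotation h n z))
      rw [← model_u₂, CKFamily.u₂_eq_el, hγ.map_el, ← CKFamily.u₂_eq_el, model_u₂, ← map_smul]
      congr 1
      ext x
      simp [gaugeRotation_apply]
  exact key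

theorem map_mat (hγ : IsGaugeAt R h n z γ) (i j : ℕ+) (g : C(X, ℂ)) :
    γ (R.mat i j g) = ((z 0 ^ ((j : ℤ) - i) : Circle) : ℂ) •
      R.mat i j (g.comp (gaugeRotation h n z)) := by
  have h1 : R.mat i j g = R.mat n j 1 * R.mat n n g * R.mat i n 1 := by
    rw [R.mat_mul_same, R.mat_mul_same, one_mul, mul_one]
  rw [h1, map_mul, map_mul, hγ.map_mat_one, hγ.map_mat_one, hγ.map_mat_self, smul_mul_assoc,
    smul_mul_smul_comm, R.mat_mul_same, R.mat_mul_same, one_mul, mul_one, ← Circle.coe_mul,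
    ← zpow_add, sub_add_sub_cancel]

end IsGaugeAt

/-! ### Gauge-equivariant functions on the torus. -/

theorem Circle.exists_pow_eq (n : ℕ+) (c : Circle) : ∃ z : Circle, z ^ (n : ℕ) = c := by
  refine ⟨Circle.exp (Complex.arg c / n), ?_⟩
  rw [← Circle.exp_nsmul, nsmul_eq_mul, mul_div_cancel₀ _ (by exact_mod_cast n.ne_zero), Circle.exp_arg]

theorem Circle.exists_primitive (n : ℕ+) :
    ∃ ζ : Circle, ζ ^ (n : ℕ) = 1 ∧ ∀ k : ℤ, ζ ^ k = 1 → (n : ℤ) ∣ k := by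
  have hp := Complex.isPrimitiveRoot_exp (n : ℕ) n.ne_zero
  let ζ : Circle := ⟨_, mem_sphere_zero_iff_norm.2 (hp.norm'_eq_one n.ne_zero)⟩
  refine ⟨ζ, Circle.ext hp.pow_eq_one, fun k hk => (hp.zpow_eq_one_iff_dvd k).1 ?_⟩
  exact congrArg (fun c : Circle => (c : ℂ)) hk

omit [CompactSpace X] in
/-- Scalar functions with the equivariance of a gauge-invariant matrix entry. -/
theorem eq_smul_mono_of_invariant {i j : ℕ+} {g : C(X, ℂ)}
    (hg : ∀ z : Fin 2 → Circle,
      g = ((z 0 ^ ((j : ℤ) - i) : Circle) : ℂ) • g.comp (gaugeRotation h n z)) :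
    g = 0 ∨ ∃ a : ℤ, (i : ℤ) - j = n * a ∧ ∃ c : ℂ, g = c • mono h a 0 := by
  have h1 : ∀ (x : X) (w : Circle), w ^ (n : ℕ) = (h x).1 →
      g (h.symm 1) = ((w ^ ((j : ℤ) - i) : Circle) : ℂ) * g x := fun x w hw => by
    -- These parameters rotate the base point `1` to `x`; the second one cancels the factor `w ^ (n
    -- - 1)`.
    have h2 := DFunLike.congr_fun (hg ![w, (w ^ ((n : ℕ) - 1))⁻¹ * (h x).2]) (h.symm 1)
    have h3 : gaugeRotation h n ![w, (w ^ ((n : ℕ) - 1))⁻¹ * (h x).2] (h.symm 1) = x := by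
      rw [gaugeRotation_apply, Homeomorph.apply_symm_apply, Homeomorph.symm_apply_eq]
      simp [hw]
    rw [ContinuousMap.smul_apply, ContinuousMap.comp_apply, h3] at h2
    exact h2
  by_cases h0 : g (h.symm 1) = 0
  · left
    ext x
    obtain ⟨w, hw⟩ := Circle.exists_pow_eq n (h x).1
    have h2 := h1 x w hw
    rw [h0] at h2
    exact (mul_eq_zero.1 h2.symm).resolve_left (Circle.coe_ne_zero _)
  · right
    obtain ⟨ζ, hζ, hζ'⟩ := Circle.exists_primitive n
    -- A primitive `n`-th root of unity fixes the base point. As `g` does not vanish there, its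
    -- factor `ζ ^ (j - i)` is `1`.
    have h2 := h1 (h.symm 1) ζ (by simpa using hζ)
    have h3 : ζ ^ ((j : ℤ) - i) = 1 := Circle.ext (by
      rw [Circle.coe_one]
      exact (mul_eq_right₀ h0).1 h2.symm)
    obtain ⟨a, ha⟩ := hζ' _ h3
    refine ⟨-a, by rw [mul_neg, ← ha, neg_sub], g (h.symm 1), ?_⟩
    ext x
    obtain ⟨w, hw⟩ := Circle.exists_pow_eq n (h x).1
    rw [ContinuousMap.smul_apply, mono_apply, h1 x w hw, ha, zpow_mul, zpow_natCast, hw, smul_eq_mul,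
      mul_right_comm, ← Circle.coe_mul]
    simp

/-! ### The core -/

/-- The `k`-th vertex in the residue class of `r + 1` modulo `n`. -/
def classIndex (r : Fin n) (k : ℕ+) : ℕ+ := ⟨((k : ℕ) - 1) * n + r + 1, Nat.succ_pos _⟩

theorem classIndex_coe (r : Fin n) (k : ℕ+) : (classIndex r k : ℤ) = (k - 1) * n + r + 1 := by
  have hk : ((k : ℕ) - 1 : ℕ) = ((k : ℤ) - 1) := by have := k.pos; omega
  rw [← hk]
  exact_mod_cast rfl

theorem classIndex_mod (r : Fin n) (k : ℕ+) : ((classIndex r k : ℕ) - 1) % n = r := by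
  rw [classIndex, PNat.mk_coe, Nat.add_sub_cancel, Nat.mul_add_mod']
  exact Nat.mod_eq_of_lt r.2

theorem classIndex_ne {r s : Fin n} (hrs : r ≠ s) (k l : ℕ+) : classIndex r k ≠ classIndex s l :=
  fun h => hrs (Fin.ext (by rw [← classIndex_mod r k, h, classIndex_mod]))

theorem classIndex_injective (r : Fin n) : Function.Injective (classIndex r) := fun k l hkl => by
  have h1 := classIndex_coe r k
  rw [hkl, classIndex_coe] at h1
  have h2 : ((l : ℤ) - 1) * n = (k - 1) * n := by linarith
  have h3 := mul_right_cancel₀ (by exact_mod_cast n.ne_zero : ((n : ℕ) : ℤ) ≠ 0) h2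
  exact PNat.eq (by omega)

theorem exists_classIndex (n i : ℕ+) : ∃ (r : Fin n) (k : ℕ+), classIndex r k = i := by
  refine ⟨⟨((i : ℕ) - 1) % n, Nat.mod_lt _ n.pos⟩, ⟨((i : ℕ) - 1) / n + 1, Nat.succ_pos _⟩, PNat.eq ?_⟩
  have := Nat.div_add_mod' ((i : ℕ) - 1) n
  have := i.pos
  simp only [classIndex, PNat.mk_coe, Nat.add_sub_cancel]
  omega

theorem classIndex_eq_of_dvd {i j : ℕ+} {a : ℤ} (hij : (i : ℤ) - j = n * a) :
    ∃ (r : Fin n) (k l : ℕ+), classIndex r k = i ∧ classIndex r l = j ∧ a = k - l := by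
  obtain ⟨r, k, rfl⟩ := exists_classIndex n i
  obtain ⟨s, l, rfl⟩ := exists_classIndex n j
  rw [classIndex_coe, classIndex_coe] at hij
  have hn : (0 : ℤ) < n := by exact_mod_cast n.pos
  have hd : (n : ℤ) ∣ (r : ℤ) - s := ⟨a - k + l, by linarith⟩
  have hrs : (r : ℤ) - s = 0 := Int.eq_zero_of_abs_lt_dvd hd (by
    have := r.2
    have := s.2
    rw [abs_lt]
    constructor <;> omega)
  have hrs' : r = s := Fin.ext (by omega)
  subst hrs'
  refine ⟨r, k, l, rfl, rfl, mul_left_cancel₀ hn.ne' ?_⟩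
  rw [← hij]
  ring

variable (R h) in
/-- The matrix units of the `r`-th summand of the core. -/
noncomputable def coreUnit (r : Fin n) (k l : ℕ+) : C(X, K) :=
  R.mat (classIndex r k) (classIndex r l) (mono h ((k : ℤ) - l) 0)

variable (R h) in
-- The exponents `k - l` telescope in products, so the monomials do not disturb the matrix unit
-- relations.
theorem isMatrixUnits_coreUnit (r : Fin n) :
    IsMatrixUnits (fun l k => coreUnit R h r k l) where
  mul_eq i j k l := by
    split_ifs with hjk
    · subst hjk
      rw [coreUnit, coreUnit, R.mat_mul_same, mono_mul, coreUnit]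
      congr 2
      ring
    · exact R.mat_mul_ne (fun h' => hjk (classIndex_injective r h')) _ _
  star_eq i j := by
    rw [coreUnit, R.star_mat, star_mono, neg_sub, neg_zero, coreUnit]

/-- The matrix unit contributes `(z 0) ^ (n * (l - k))`, and the rotation of the monomial
contributes the inverse. -/
theorem IsGaugeAt.map_coreUnit (hγ : IsGaugeAt R h n z γ) (r : Fin n) (k l : ℕ+) :
    γ (coreUnit R h r k l) = coreUnit R h r k l := by
  rw [coreUnit, hγ.map_mat, ← map_smul]
  congr 1
  ext x
  have h1 : (z 0 ^ ((classIndex r l : ℤ) - classIndex r k)) * (z 0 ^ (n : ℕ)) ^ ((k : ℤ) - l) = 1 := by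
    rw [← zpow_natCast, ← zpow_mul, ← zpow_add, classIndex_coe, classIndex_coe]
    have : ((l : ℤ) - 1) * n + r + 1 - ((k - 1) * n + r + 1) + ((n : ℕ) : ℤ) * (k - l) = 0 := by ring
    rw [this, zpow_zero]
  rw [ContinuousMap.smul_apply, ContinuousMap.comp_apply, mono_apply, mono_apply,
    gaugeRotation_apply, Homeomorph.apply_symm_apply, smul_eq_mul, ← Circle.coe_mul, mul_zpow,
    ← mul_assoc, ← mul_assoc, h1, one_mul, zpow_zero, zpow_zero]

variable (R h n) in
/-- The direct sum of `n` copies of `K` embeds into `C(X, K)` as the gauge-invariant part. -/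
theorem exists_core_hom : ∃ Ω : (Fin n → K) →⋆ₙₐ[ℂ] C(X, K), Function.Injective Ω ∧
    (∀ z γ, IsGaugeAt R h n z γ → ∀ T, γ (Ω T) = Ω T) ∧
    ∀ f, (∀ z, ∃ γ, IsGaugeAt R h n z γ ∧ γ f = f) → ∃ T, Ω T = f := by
  have hex := fun r : Fin n => (isMatrixUnits_coreUnit R h r).exists_hom_of_units R
  choose Ψ hΨ using hex
  have hc : ∀ r, Continuous (Ψ r) := fun r => continuous_starHom _
  -- Different residue classes use disjoint rows and columns; density of the matrix units extends
  -- this to one variable at a time.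
  have horth : ∀ r s, r ≠ s → ∀ T T', Ψ r T * Ψ s T' = 0 := fun r s hrs T T' => by
    have h1 : ∀ i j, Ψ r (R.unit i j) * Ψ s T' = 0 := fun i j => by
      let L : K →ₗ[ℂ] C(X, K) := LinearMap.mulLeft ℂ (Ψ r (R.unit i j)) ∘ₗ (Ψ s : K →ₗ[ℂ] C(X, K))
      have hL : Continuous L := continuous_const.mul (hc s)
      refine R.mem_of_forall_unit_mem (W := LinearMap.ker L) (isClosed_eq hL continuous_const)
        (fun k l => ?_) T'
      change Ψ r (R.unit i j) * Ψ s (R.unit k l) = 0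
      rw [hΨ, hΨ]
      exact R.mat_mul_ne (classIndex_ne hrs _ _) _ _
    let L : K →ₗ[ℂ] C(X, K) := LinearMap.mulRight ℂ (Ψ s T') ∘ₗ (Ψ r : K →ₗ[ℂ] C(X, K))
    have hL : Continuous L := (hc r).mul continuous_const
    exact R.mem_of_forall_unit_mem (W := LinearMap.ker L) (isClosed_eq hL continuous_const) h1 T
  let Ω : (Fin n → K) →⋆ₙₐ[ℂ] C(X, K) :=
    { toFun := fun T => ∑ r, Ψ r (T r)
      map_smul' := fun c T => by simp [Finset.smul_sum]
      map_zero' := by simp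
      map_add' := fun T T' => by simp [Finset.sum_add_distrib]
      map_mul' := fun T T' => by
        rw [Finset.sum_mul_sum]
        refine Finset.sum_congr rfl fun r _ => ?_
        rw [Finset.sum_eq_single r (fun s _ hsr => horth r s (Ne.symm hsr) _ _) (by simp)]
        exact map_mul (Ψ r) _ _
      map_star' := fun T => by
        rw [star_sum]
        exact Finset.sum_congr rfl fun r _ => map_star (Ψ r) _ }
  have hΩ : ∀ T, Ω T = ∑ r, Ψ r (T r) := fun T => rfl
  have hsingle : ∀ r T, Ω (Pi.single r T) = Ψ r T := fun r T => by
    rw [hΩ, Finset.sum_eq_single r (fun s _ hsr => by rw [Pi.single_eq_of_ne hsr, map_zero])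
      (by simp), Pi.single_eq_same]
  have hinj : Function.Injective Ω := by
    rw [injective_iff_map_eq_zero]
    intro T hT
    funext r
    refine R.eq_zero_of_entry fun i j => ?_
    -- Cutting `T` down to one entry of one summand stays in the kernel and leaves a multiple of a
    -- unit with nonzero image.
    have h1 : Pi.single r (R.unit j j) * T * Pi.single r (R.unit i i)
        = Pi.single r (R.entry i j (T r) • R.unit i j) := by
      rw [← R.mul_mul]
      funext s
      by_cases hs : s = r
      · subst hs; simp
      · simp [Pi.single_eq_of_ne hs]
    have h2 := congrArg Ω h1
    rw [map_mul, map_mul, hT, mul_zero, zero_mul, hsingle, map_smul, hΨ] at h2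
    refine (smul_eq_zero.1 h2.symm).resolve_right fun h3 => ?_
    have h4 := R.mat_injective _ _ (h3.trans (map_zero _).symm)
    have h5 := DFunLike.congr_fun h4 (h.symm 1)
    rw [mono_apply, ContinuousMap.zero_apply] at h5
    exact Circle.coe_ne_zero _ h5
  refine ⟨Ω, hinj, fun z γ hγ T => ?_, fun f hf => ?_⟩
  · rw [hΩ, map_sum]
    refine Finset.sum_congr rfl fun r _ => ?_
    refine R.mem_of_forall_unit_mem
      (W := LinearMap.eqLocus ((γ.comp (Ψ r) : K →⋆ₙₐ[ℂ] C(X, K)) : K →ₗ[ℂ] C(X, K))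
        (Ψ r : K →ₗ[ℂ] C(X, K))) (isClosed_eq (continuous_starHom (γ.comp (Ψ r))) (hc r))
      (fun k l => ?_) (T r)
    change γ (Ψ r (R.unit k l)) = Ψ r (R.unit k l)
    rw [hΨ, hγ.map_coreUnit]
  -- The range of an injective homomorphism is closed, so it suffices to reach every corner of `f`.
  · have hiso : Isometry Ω :=
      AddMonoidHomClass.isometry_of_norm Ω (NonUnitalStarAlgHom.norm_map Ω hinj)
    refine R.mem_of_forall_mat_mem (W := LinearMap.range (Ω : (Fin n → K) →ₗ[ℂ] C(X, K)))
      hiso.isClosedEmbedding.isClosed_range fun i j => ?_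
    -- The diagonal units are fixed by `γ`, so invariance of `f` passes to its corners.
    have hinv : ∀ z : Fin 2 → Circle, R.fnEntry i j f
        = ((z 0 ^ ((j : ℤ) - i) : Circle) : ℂ) • (R.fnEntry i j f).comp (gaugeRotation h n z) :=
      fun z => by
        obtain ⟨γ, hγ, hfix⟩ := hf z
        refine R.mat_injective i j ?_
        rw [map_smul, ← hγ.map_mat, ← R.mat_mul_mul, map_mul, map_mul, hfix, hγ.map_mat_one,
          hγ.map_mat_one]
        simp
    rcases eq_smul_mono_of_invariant hinv with h0 | ⟨a, ha, c, hg⟩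
    · exact ⟨0, by rw [h0, map_zero, map_zero]⟩
    · obtain ⟨r, k, l, rfl, rfl, rfl⟩ := classIndex_eq_of_dvd ha
      refine ⟨Pi.single r (c • R.unit k l), ?_⟩
      change Ω _ = _
      rw [hsingle, map_smul, hΨ, hg, map_smul, coreUnit]

end gauge

/-! ### The core of an arbitrary realisation and the final assembly. -/

theorem nonempty_core_equiv {A : Type u} [NonUnitalCStarAlgebra A] {K : Type}
    [NonUnitalCStarAlgebra K] (R : RankOneUnits K) {n : ℕ+} {S : CKFamily (LambdaN n) A}
    (hS : S.IsUniversal) : Nonempty (CKFamily.core hS ≃⋆ₐ[ℂ] (Fin n → K)) := by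
  let h : ULift.{u} (Circle × Circle) ≃ₜ Circle × Circle := Homeomorph.ulift
  obtain ⟨Φ, hΦ⟩ := hS.exists_equiv R h
  obtain ⟨Ω, hinj, hfix, hsurj⟩ := exists_core_hom R h n
  -- The gauge action, transported to the model by conjugation with `Φ`.
  let γ : (Fin 2 → Circle) → C(ULift.{u} (Circle × Circle), K) →⋆ₙₐ[ℂ] C(ULift.{u} (Circle × Circle), K) := fun z =>
    ((Φ : A →⋆ₙₐ[ℂ] C(ULift.{u} (Circle × Circle), K)).comp (CKFamily.gauge hS z)).comp (Φ.symm : C(ULift.{u} (Circle × Circle), K) →⋆ₙₐ[ℂ] A)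
  have hγ : ∀ z, IsGaugeAt R h n z (γ z) := fun z v w l => by
    change Φ (CKFamily.gauge hS z (Φ.symm ((model R h n).S l))) = _
    rw [← hΦ, StarAlgEquiv.symm_apply_apply, CKFamily.gauge_apply, map_smul]
  have hmem : ∀ T, (Φ.symm : C(ULift.{u} (Circle × Circle), K) →⋆ₙₐ[ℂ] A).comp Ω T ∈ CKFamily.core hS := fun T z => by
    have h1 := hfix z _ (hγ z) T
    change Φ (CKFamily.gauge hS z (Φ.symm (Ω T))) = Ω T at h1
    change CKFamily.gauge hS z (Φ.symm (Ω T)) = Φ.symm (Ω T)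
    rw [eq_comm, StarAlgEquiv.symm_apply_eq, h1]
  let q : (Fin n → K) →⋆ₙₐ[ℂ] CKFamily.core hS :=
    NonUnitalStarAlgHom.codRestrict ((Φ.symm : C(ULift.{u} (Circle × Circle), K) →⋆ₙₐ[ℂ] A).comp Ω) (CKFamily.core hS) hmem
  have hq : Function.Bijective q := by
    constructor
    · intro T T' hT
      exact hinj (EquivLike.injective Φ.symm (congrArg Subtype.val hT))
    · rintro ⟨a, ha⟩
      obtain ⟨T, hT⟩ := hsurj (Φ a) fun z => ⟨γ z, hγ z, by
        change Φ (CKFamily.gauge hS z (Φ.symm (Φ a))) = Φ a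
        rw [StarAlgEquiv.symm_apply_apply, ha z]⟩
      refine ⟨T, Subtype.ext ?_⟩
      change Φ.symm (Ω T) = a
      rw [hT, StarAlgEquiv.symm_apply_apply]
  exact ⟨(StarAlgEquiv.ofBijective q hq).symm⟩

theorem lemma7p2 (n : ℕ+) :
    -- the universal C*-algebra of the 2-graph exists
    (∃ (A : Type u) (_ : NonUnitalCStarAlgebra A) (S : CKFamily (LambdaN n) A), S.IsUniversal) ∧
    -- and every realisation of it has the stated structure
    ∀ (A : Type u) [NonUnitalCStarAlgebra A] (S : CKFamily (LambdaN n) A) (hS : S.IsUniversal),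
      IsMatrixUnits (fun j i : ℕ+ => S.theta i j) ∧
      (∀ i j : ℕ+, S.theta i j ≠ 0) ∧
      (∃ U₁ U₂ : unitary 𝓜(ℂ, A),
        HasStrictSum (fun j : ℕ+ => S.theta n j * S.u₁ * S.theta j n) (U₁ : 𝓜(ℂ, A)) ∧
        HasStrictSum (fun j : ℕ+ => S.theta n j * S.u₂ * S.theta j n) (U₂ : 𝓜(ℂ, A)) ∧
        U₁ * U₂ = U₂ * U₁ ∧
        spectrum ℂ (U₁ : 𝓜(ℂ, A)) = Metric.sphere 0 1 ∧
        spectrum ℂ (U₂ : 𝓜(ℂ, A)) = Metric.sphere 0 1 ∧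
        -- `M.snd x` is the product `x M` of `x : A` with the multiplier `M`
        closure (Submodule.span ℂ {x : A | ∃ (i j : ℕ+) (a b : ℤ),
          x = ((U₁ ^ a * U₂ ^ b : unitary 𝓜(ℂ, A)) : 𝓜(ℂ, A)).snd (S.theta i j)} : Set A)
            = Set.univ ∧
        ∃ Φ : A ≃⋆ₐ[ℂ] C(Circle × Circle, CompactOps),
          ∀ (i j : ℕ+) (a b : ℤ) (w z : Circle),
            (Φ (((U₁ ^ a * U₂ ^ b : unitary 𝓜(ℂ, A)) : 𝓜(ℂ, A)).snd (S.theta i j)) (w, z) :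
              EllTwo →L[ℂ] EllTwo) = ((w ^ a * z ^ b : Circle) : ℂ) • Theta i j) ∧
      Nonempty (CKFamily.core hS ≃⋆ₐ[ℂ] (Fin n → CompactOps)) := by
  refine ⟨⟨_, _, _, isUniversal_model compactUnits
    (Homeomorph.ulift.{u} : ULift.{u} (Circle × Circle) ≃ₜ Circle × Circle)⟩, ?_⟩
  intro A _ S hS
  obtain ⟨hne, U₁, U₂, h₁, h₂, hc, hs₁, hs₂, hspan, Φ, hΦ⟩ := structure_of_isUniversal compactUnits hS
  exact ⟨S.isMatrixUnits_theta, hne, ⟨U₁, U₂, h₁, h₂, hc, hs₁, hs₂, hspan, Φ, fun i j a b w z =>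
    congrArg Subtype.val (hΦ i j a b w z)⟩, nonempty_core_equiv compactUnits hS⟩
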